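/- **Notation.** Let $n\ge 1$, $\Gamma_n=\mathrm{Sp}_n(\mathbf Z)$ (of size $2n\times 2n$), and let $\mathbf H_n$ be the Siegel upper half space of symmetric $Z=X+iY\in M_n(\mathbf C)$ with $Y>0$. For a congruence subgroup $\Gamma\subseteq\Gamma_n$ and an integer $k\ge 0$, let $S^n_k(\Gamma)$ be the space of Siegel cusp forms of degree $n$ and weight $k$: holomorphic $F:\mathbf H_n\to\mathbf C$ with $F|_k\gamma=F$ for $\gamma\in\Gamma$, where $(F|_kg)(Z)=\det(CZ+D)^{-k}F((AZ+B)(CZ+D)^{-1})$ for $g=\begin{pmatrix}A&B\\C&D\end{pmatrix}\in\Gamma_n$, such that for every $g\in\Gamma_n$ the Fourier expansion of $F|_kg$ is supported on positive definite matrices. Put $$\langle F,G\rangle=\int_{\Gamma\backslash\mathbf H_n}F\,\overline G\,\det(Y)^k\,d\mu,\qquad d\mu=\det(Y)^{-(n+1)}\,dX\,dY,$$ (integral over any fundamental domain, not volume-normalised), call $G$ $L^2$-normalised if $\langle G,G\rangle=1$, and put $$\|G\|_\infty=\sup_{Z\in\mathbf H_n}\det(Y)^{k/2}|G(Z)|,\qquad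 \sup(S^n_k(\Gamma))=\sup_{Z\in\mathbf H_n}\sum_{F\in B}\det(Y)^k|F(Z)|^2,$$ where $B$ is an orthonormal basis of $S^n_k(\Gamma)$ (the sum does not depend on $B$). **Theorem.** Let $n\ge1$, $\alpha\ge 0$ and $\kappa_0\in\mathbf N$. 1. (Weight and hybrid aspects.) For every constant $C$ there is a constant $C'$, depending only on $n,\alpha,\kappa_0,C$, such that for every congruence subgroup $\Gamma\subseteq\Gamma_n$ with $$\sup(S^n_\kappa(\Gamma))\le C\,\kappa^{2\alpha}\quad\text{for all integers }\kappa\ge\kappa_0,$$ every integer $k\ge n/2$ and every $L^2$-normalised $G\in S^n_k(\Gamma)$ one has $\|G\|_\infty\le C'\,k^{\alpha}$. (If $C$ depends on $n$ and $\Gamma$, this is the weight aspect; if $C$ depends on $n$ only, the hybrid aspect.) 2. (Level aspect.) For all constants $C_\kappa$ ($\kappa\in\mathbf N$) and every integer $k\ge n/2$ there is a constant $C'_k$, depending only on $n,\alpha,\kappa_0,(C_\kappa)_\kappa$ and $k$, such that for every congruence subgroup $\Gamma\subseteq\Gamma_n$ with $$\sup(S^n_\kappa(\Gamma))\le C_\kappa\,\kappa^{2\alpha}\quad\text{for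 all integers }\kappa\ge\kappa_0$$ every $L^2$-normalised $G\in S^n_k(\Gamma)$ satisfies $\|G\|_\infty\le C'_k\,k^{\alpha}$. -/

import Mathlib

open MeasureTheory
open scoped Matrix ENNReal ComplexConjugate

noncomputable section

namespace SiegelSize

/-- The Siegel modular group `Γ_n = Sp_n(ℤ)` of `2n × 2n` integral symplectic matrices. -/
abbrev SpZ (n : ℕ) : Type := Matrix.symplecticGroup (Fin n) ℤ

/-- The blocks `A, B, C, D` of `g = (A B; C D) ∈ Sp_n(ℤ)`, as complex matrices. -/
def blockA {n : ℕ} (g : SpZ n) : Matrix (Fin n) (Fin n) ℂ :=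
  (g : Matrix (Fin n ⊕ Fin n) (Fin n ⊕ Fin n) ℤ).toBlocks₁₁.map (Int.cast : ℤ → ℂ)

/-- The upper right block `B` of `g`. -/
def blockB {n : ℕ} (g : SpZ n) : Matrix (Fin n) (Fin n) ℂ :=
  (g : Matrix (Fin n ⊕ Fin n) (Fin n ⊕ Fin n) ℤ).toBlocks₁₂.map (Int.cast : ℤ → ℂ)

/-- The lower left block `C` of `g`. -/
def blockC {n : ℕ} (g : SpZ n) : Matrix (Fin n) (Fin n) ℂ :=
  (g : Matrix (Fin n ⊕ Fin n) (Fin n ⊕ Fin n) ℤ).toBlocks₂₁.map (Int.cast : ℤ → ℂ)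

/-- The lower right block `D` of `g`. -/
def blockD {n : ℕ} (g : SpZ n) : Matrix (Fin n) (Fin n) ℂ :=
  (g : Matrix (Fin n ⊕ Fin n) (Fin n ⊕ Fin n) ℤ).toBlocks₂₂.map (Int.cast : ℤ → ℂ)

/-- The imaginary part `Y` of `Z = X + iY` (for symmetric `Z` this is `(Z - Z̄)/2i`). -/
def imPart {n : ℕ} (Z : Matrix (Fin n) (Fin n) ℂ) : Matrix (Fin n) (Fin n) ℝ :=
  Z.map Complex.im

/-- Siegel's upper half space `H_n`: symmetric complex matrices with positive definite
imaginary part. -/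
def siegelH (n : ℕ) : Set (Matrix (Fin n) (Fin n) ℂ) :=
  {Z | Zᵀ = Z ∧ (imPart Z).PosDef}

/-- The automorphy factor `J(g, Z) = det(CZ + D)`. -/
def autFactor {n : ℕ} (g : SpZ n) (Z : Matrix (Fin n) (Fin n) ℂ) : ℂ :=
  (blockC g * Z + blockD g).det

/-- The action `g⟨Z⟩ = (AZ + B)(CZ + D)⁻¹`. -/
def moeb {n : ℕ} (g : SpZ n) (Z : Matrix (Fin n) (Fin n) ℂ) : Matrix (Fin n) (Fin n) ℂ :=
  (blockA g * Z + blockB g) * (blockC g * Z + blockD g)⁻¹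

/-- The weight `k` stroke operator `(F|_k g)(Z) = det(CZ + D)^{-k} F(g⟨Z⟩)`. -/
def slash {n : ℕ} (k : ℕ) (F : Matrix (Fin n) (Fin n) ℂ → ℂ) (g : SpZ n)
    (Z : Matrix (Fin n) (Fin n) ℂ) : ℂ :=
  ((autFactor g Z) ^ k)⁻¹ * F (moeb g Z)

/-- The principal congruence subgroup `Γ^{(n)}(N)`, as a set: `g ≡ 1_{2n} mod N`. -/
def principalCongruence (n N : ℕ) : Set (SpZ n) :=
  {g | ∀ i j, (N : ℤ) ∣ (g : Matrix (Fin n ⊕ Fin n) (Fin n ⊕ Fin n) ℤ) i j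
    - (1 : Matrix (Fin n ⊕ Fin n) (Fin n ⊕ Fin n) ℤ) i j}

/-- `Γ ⊆ Sp_n(ℤ)` is a congruence subgroup. -/
def IsCongruence {n : ℕ} (Γ : Subgroup (SpZ n)) : Prop :=
  ∃ N : ℕ, 1 ≤ N ∧ principalCongruence n N ⊆ (Γ : Set (SpZ n))

/-- The conjugate `g⁻¹ Γ g`. -/
def conjSubgroup {n : ℕ} (Γ : Subgroup (SpZ n)) (g : SpZ n) : Subgroup (SpZ n) :=
  Γ.map (MulAut.conj g⁻¹).toMonoidHom

/-- The lattice `𝒮_Γ` of symmetric integral `S` such that `(1 S; 0 1) ∈ Γ`. -/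
def transLattice {n : ℕ} (Γ : Subgroup (SpZ n)) : Set (Matrix (Fin n) (Fin n) ℤ) :=
  {S | Sᵀ = S ∧ ∃ γ ∈ Γ,
    (γ : Matrix (Fin n ⊕ Fin n) (Fin n ⊕ Fin n) ℤ) = Matrix.fromBlocks 1 S 0 1}

/-- `Λ_Γ`: the positive definite elements of the lattice dual to `𝒮_Γ` under the trace pairing
(`Matrix.PosDef` includes symmetry). -/
def posDual {n : ℕ} (Γ : Subgroup (SpZ n)) : Set (Matrix (Fin n) (Fin n) ℝ) :=
  {T | T.PosDef ∧ ∀ S ∈ transLattice Γ,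
    ∃ q : ℤ, (T * S.map (Int.cast : ℤ → ℝ)).trace = q}

/-- `e(TZ) = exp(2πi tr(TZ))`. -/
def expTrace {n : ℕ} (T : Matrix (Fin n) (Fin n) ℝ) (Z : Matrix (Fin n) (Fin n) ℂ) : ℂ :=
  Complex.exp (2 * Real.pi * Complex.I * (T.map (Complex.ofReal) * Z).trace)

/-- The symmetric matrix with entries `z_{ij}`, `i ≤ j`. The unordered pairs `{i, j}` index the
`n(n+1)/2` coordinates of the space of symmetric complex matrices. -/
def symMat {n : ℕ} (z : Sym2 (Fin n) → ℂ) : Matrix (Fin n) (Fin n) ℂ :=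
  Matrix.of fun i j => z s(i, j)

/-- The space `S^n_k(Γ)` of Siegel cusp forms of degree `n` and weight `k` on `Γ`. A function on
`H_n` is represented by its extension by zero to all matrices. -/
def cuspForms {n : ℕ} (k : ℕ) (Γ : Subgroup (SpZ n)) :
    Submodule ℂ (Matrix (Fin n) (Fin n) ℂ → ℂ) where
  carrier := {F |
    (∀ Z, Z ∉ siegelH n → F Z = 0) ∧
    DifferentiableOn ℂ (fun z => F (symMat z)) {z | symMat z ∈ siegelH n} ∧
    (∀ γ ∈ Γ, ∀ Z ∈ siegelH n, slash k F γ Z = F Z) ∧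
    ∀ g : SpZ n, ∃ a : posDual (conjSubgroup Γ g) → ℂ, ∀ Z ∈ siegelH n,
      HasSum (fun T => a T * expTrace T.1 Z) (slash k F g Z)}
  add_mem' := by
    rintro F G ⟨hF0, hF1, hF2, hF3⟩ ⟨hG0, hG1, hG2, hG3⟩
    refine ⟨fun Z hZ => by simp [hF0 Z hZ, hG0 Z hZ], hF1.add hG1, fun γ hγ Z hZ => ?_,
      fun g => ?_⟩
    · have h1 := hF2 γ hγ Z hZ
      have h2 := hG2 γ hγ Z hZ
      simp only [slash, Pi.add_apply, mul_add] at h1 h2 ⊢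
      rw [h1, h2]
    · obtain ⟨a, ha⟩ := hF3 g
      obtain ⟨b, hb⟩ := hG3 g
      refine ⟨fun T => a T + b T, fun Z hZ => ?_⟩
      have h := (ha Z hZ).add (hb Z hZ)
      simp only [slash, Pi.add_apply, mul_add, add_mul] at h ⊢
      exact h
  zero_mem' := by
    refine ⟨fun Z _ => rfl, differentiableOn_const 0, fun γ _ Z _ => by simp [slash],
      fun g => ⟨fun _ => 0, fun Z _ => ?_⟩⟩
    simp [slash, hasSum_zero]
  smul_mem' := by
    rintro c F ⟨hF0, hF1, hF2, hF3⟩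
    refine ⟨fun Z hZ => by simp [hF0 Z hZ], hF1.const_smul c, fun γ hγ Z hZ => ?_, fun g => ?_⟩
    · have h1 := hF2 γ hγ Z hZ
      simp only [slash, Pi.smul_apply, smul_eq_mul] at h1 ⊢
      rw [mul_left_comm, h1]
    · obtain ⟨a, ha⟩ := hF3 g
      refine ⟨fun T => c * a T, fun Z hZ => ?_⟩
      have h := (ha Z hZ).mul_left c
      simp only [slash, Pi.smul_apply, smul_eq_mul] at h ⊢
      rw [mul_left_comm]
      simpa [mul_assoc] using h

/-- The invariant measure `dμ = det(Y)^{-(n+1)} dX dY` on `H_n`, in the coordinates `z_{ij}`,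
`i ≤ j`, of a symmetric matrix, where `dX dY = ∏_{i ≤ j} dx_{ij} dy_{ij}` is Lebesgue measure. -/
def siegelMeasure (n : ℕ) : Measure (Sym2 (Fin n) → ℂ) :=
  ((volume : Measure (Sym2 (Fin n) → ℂ)).restrict {z | symMat z ∈ siegelH n}).withDensity
    fun z => ENNReal.ofReal (((imPart (symMat z)).det ^ (n + 1))⁻¹)

/-- `𝓕` is a (measurable) fundamental domain for the action of `Γ` on `H_n`: its translates cover
`H_n` up to a null set, and an element of `Γ` other than `±1` maps only a null set of points
of `𝓕` into `𝓕`. -/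
def IsFundDomain {n : ℕ} (Γ : Subgroup (SpZ n)) (𝓕 : Set (Matrix (Fin n) (Fin n) ℂ)) : Prop :=
  MeasurableSet {z : Sym2 (Fin n) → ℂ | symMat z ∈ 𝓕} ∧ 𝓕 ⊆ siegelH n ∧
  (∀ᵐ z ∂(siegelMeasure n), ∃ γ ∈ Γ, moeb γ (symMat z) ∈ 𝓕) ∧
  ∀ γ ∈ Γ,
    (γ : Matrix (Fin n ⊕ Fin n) (Fin n ⊕ Fin n) ℤ) ≠ 1 →
    (γ : Matrix (Fin n ⊕ Fin n) (Fin n ⊕ Fin n) ℤ) ≠ -1 →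
    siegelMeasure n {z | symMat z ∈ 𝓕 ∧ moeb γ (symMat z) ∈ 𝓕} = 0

/-- The (not volume-normalised) Petersson inner product
`⟨F, G⟩ = ∫_{Γ\H_n} F conj(G) det(Y)^k dμ`, the integral being over the fundamental domain `𝓕`. -/
def petersson {n : ℕ} (k : ℕ) (𝓕 : Set (Matrix (Fin n) (Fin n) ℂ))
    (F G : Matrix (Fin n) (Fin n) ℂ → ℂ) : ℂ :=
  ∫ z in {z | symMat z ∈ 𝓕},
    F (symMat z) * conj (G (symMat z)) * (((imPart (symMat z)).det ^ k : ℝ) : ℂ)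
    ∂(siegelMeasure n)

/-- `B` is an orthonormal set of cusp forms. -/
def IsOrthonormalSet {n : ℕ} (k : ℕ) (Γ : Subgroup (SpZ n))
    (𝓕 : Set (Matrix (Fin n) (Fin n) ℂ)) (B : Set (Matrix (Fin n) (Fin n) ℂ → ℂ)) : Prop :=
  B ⊆ (cuspForms k Γ : Set _) ∧ (∀ F ∈ B, petersson k 𝓕 F F = 1) ∧
    ∀ F ∈ B, ∀ G ∈ B, F ≠ G → petersson k 𝓕 F G = 0

/-- `B` is an orthonormal basis of `S^n_k(Γ)`, i.e. a maximal orthonormal set of cusp forms. -/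
def IsOrthonormalBasis {n : ℕ} (k : ℕ) (Γ : Subgroup (SpZ n))
    (𝓕 : Set (Matrix (Fin n) (Fin n) ℂ)) (B : Set (Matrix (Fin n) (Fin n) ℂ → ℂ)) : Prop :=
  IsOrthonormalSet k Γ 𝓕 B ∧ ∀ B', IsOrthonormalSet k Γ 𝓕 B' → B ⊆ B' → B' = B

/-- The Bergman kernel on the diagonal, `∑_{F ∈ B} det(Y)^k |F(Z)|²`. -/
def bergman {n : ℕ} (k : ℕ) (B : Set (Matrix (Fin n) (Fin n) ℂ → ℂ))
    (Z : Matrix (Fin n) (Fin n) ℂ) : ℝ≥0∞ :=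
  ∑' F : B, ENNReal.ofReal ((imPart Z).det ^ k * ‖F.1 Z‖ ^ 2)

/-- The size `sup(S^n_k(Γ)) = sup_Z ∑_{F ∈ B} det(Y)^k |F(Z)|²`. The right-hand side is the same
for all orthonormal bases `B`; the supremum over `B` only avoids having to choose one. -/
def size {n : ℕ} (k : ℕ) (Γ : Subgroup (SpZ n)) (𝓕 : Set (Matrix (Fin n) (Fin n) ℂ)) : ℝ≥0∞ :=
  ⨆ (B : Set (Matrix (Fin n) (Fin n) ℂ → ℂ)) (_ : IsOrthonormalBasis k Γ 𝓕 B),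
    ⨆ Z ∈ siegelH n, bergman k B Z

/-- The sup-norm `‖G‖_∞ = sup_{Z ∈ H_n} det(Y)^{k/2} |G(Z)|` of a form of weight `k`. -/
def supNorm {n : ℕ} (k : ℕ) (G : Matrix (Fin n) (Fin n) ℂ → ℂ) : ℝ≥0∞ :=
  ⨆ Z ∈ siegelH n, ENNReal.ofReal ((imPart Z).det ^ ((k : ℝ) / 2) * ‖G Z‖)

end SiegelSize

end

/-!
A cusp form is bounded by the size of a space of larger weight through its powers. Let `G` be a
normalised cusp form of weight `k`, put `φ = det(Y)^k |G|²` and `s = sup φ`. For `m ≥ 1` the power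
`G^m` is a cusp form of weight `km` with `⟨G^m, G^m⟩ = ∫ φ^m ≤ s^(m-1) ∫ φ = s^(m-1)`. Dividing
`G^m` by its norm and completing it to an orthonormal basis gives
`s^m ≤ sup(S_{km}(Γ)) ⟨G^m, G^m⟩ ≤ sup(S_{km}(Γ)) s^(m-1)`, that is `s ≤ sup(S_{km}(Γ))`
(`height_le_of_size_le`). With `m = max(κ₀, 1)` the hypothesis applies in weight `km ≥ κ₀`, and
`(km)^α = m^α k^α` shows that only the constant changes.

Dividing by `s^(m-1)` requires `s < ∞` (`exists_height_le`), for which no bound uniform in the group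
is needed. It follows from reduction theory and Fourier expansions:

* Every orbit of `Sp_n(ℤ)` meets the set `Y ≥ ε`, for some `ε = ε(n) > 0`
  (`exists_moeb_imPart_ge`). The height `det Im(g⟨Z⟩)` is bounded on orbits, because its inverse is
  the determinant of a positive definite form on `n` independent integral vectors
  (`exists_det_imPart_moeb_le`). Where it is at least half its supremum, an inversion in a single
  diagonal variable cannot more than double it, so all diagonal entries of `U Y Uᵀ` with
  `U ∈ GL_n(ℤ)` are at least `1/2`; the reduction theory of lattices then provides a `U` with
  `U Y Uᵀ ≥ ε` (`exists_reduced_family`).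
* On `Y ≥ ε` the Fourier expansions of the `F|_k g` bound `det(Y)^{k/2} |F|_k g|`, since the
  expansions are supported on positive definite matrices with bounded denominators
  (`exists_height_le_of_hasSum`), and only finitely many cosets of `Γ` occur.
-/

noncomputable section

namespace SiegelSize

open Matrix
open scoped ComplexOrder MatrixOrder

/-! ### Real and complex positive definite matrices -/

theorem exists_conjTranspose_mul_self_of_posDef {ι : Type*} [Fintype ι] [DecidableEq ι]
    {A : Matrix ι ι ℝ} (hA : A.PosDef) : ∃ B : Matrix ι ι ℝ, IsUnit B ∧ A = Bᵀ * B := by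
  obtain ⟨B, hB, h⟩ := CStarAlgebra.isStrictlyPositive_iff_eq_star_mul_self.mp
    (Matrix.isStrictlyPositive_iff_posDef.mpr hA)
  exact ⟨B, hB, by rw [h, star_eq_conjTranspose, conjTranspose_eq_transpose_of_trivial]⟩

theorem posDef_map_ofReal_iff {ι : Type*} [Fintype ι] [DecidableEq ι] {A : Matrix ι ι ℝ} :
    (A.map Complex.ofReal).PosDef ↔ A.PosDef := by
  constructor
  · intro h
    refine Matrix.PosDef.of_dotProduct_mulVec_pos ?_ fun x hx => ?_
    · ext i j
      have := h.isHermitian.apply i j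
      simpa [Complex.conj_ofReal] using this
    · have hx' : (fun i => (x i : ℂ)) ≠ 0 := by
        contrapose! hx
        ext i
        simpa using congrFun hx i
      have := h.dotProduct_mulVec_pos hx'
      have e : star (fun i => (x i : ℂ)) ⬝ᵥ (A.map Complex.ofReal *ᵥ fun i => (x i : ℂ)) =
          ((star x ⬝ᵥ (A *ᵥ x) : ℝ) : ℂ) := by
        simp [dotProduct, mulVec]
      rw [e] at this
      exact_mod_cast this
  · intro h
    obtain ⟨B, hB, rfl⟩ := exists_conjTranspose_mul_self_of_posDef h
    have e : (Bᵀ * B).map Complex.ofReal = star (B.map Complex.ofReal) * B.map Complex.ofReal := by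
      ext i j
      simp [Matrix.mul_apply, star_eq_conjTranspose]
    have hB' : IsUnit (B.map Complex.ofReal) := hB.map (Complex.ofRealHom.mapMatrix)
    rw [e]
    have := (hB'.posDef_star_left_conjugate_iff (x := 1)).2 PosDef.one
    simpa using this

/-! ### The action of the modular group on the upper half space -/

theorem fromBlocks_block {n : ℕ} (g : SpZ n) :
    fromBlocks (blockA g) (blockB g) (blockC g) (blockD g) =
      (g : Matrix (Fin n ⊕ Fin n) (Fin n ⊕ Fin n) ℤ).map (Int.cast : ℤ → ℂ) := by
  ext (i | i) (j | j) <;> rfl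

theorem block_relations {n : ℕ} (g : SpZ n) :
    (blockA g)ᵀ * blockC g = (blockC g)ᵀ * blockA g ∧
    (blockB g)ᵀ * blockD g = (blockD g)ᵀ * blockB g ∧
    (blockA g)ᵀ * blockD g - (blockC g)ᵀ * blockB g = 1 := by
  have h := SymplecticGroup.map_mem (A := g.1) g.2 (Int.castRingHom ℂ)
  rw [← SymplecticGroup.fromBlocks_mem_iff, fromBlocks_block]
  exact h

theorem block_relation' {n : ℕ} (g : SpZ n) :
    (blockD g)ᵀ * blockA g - (blockB g)ᵀ * blockC g = 1 := by
  have := congrArg transpose (block_relations g).2.2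
  simpa using this

theorem block_mul {n : ℕ} (g h : SpZ n) :
    blockA (g * h) = blockA g * blockA h + blockB g * blockC h ∧
    blockB (g * h) = blockA g * blockB h + blockB g * blockD h ∧
    blockC (g * h) = blockC g * blockA h + blockD g * blockC h ∧
    blockD (g * h) = blockC g * blockB h + blockD g * blockD h := by
  have h1 := fromBlocks_block (g * h)
  rw [Submonoid.coe_mul] at h1
  have h2 := (Matrix.map_mul (f := Int.castRingHom ℂ) (L := g.1) (M := h.1))
  simp only [Int.coe_castRingHom] at h2
  rw [h2, ← fromBlocks_block, ← fromBlocks_block, fromBlocks_multiply] at h1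
  exact fromBlocks_inj.1 h1

theorem conjTranspose_map_intCast {m n : Type*} (M : Matrix m n ℤ) :
    (M.map (Int.cast : ℤ → ℂ))ᴴ = (M.map (Int.cast : ℤ → ℂ))ᵀ := by
  ext i j
  simp

/-- The complex matrix `2iY` is `Z - Zᴴ` for symmetric `Z = X + iY`. -/
theorem sub_conjTranspose_of_symm {n : ℕ} {Z : Matrix (Fin n) (Fin n) ℂ} (hZ : Zᵀ = Z) :
    Z - Zᴴ = (2 * Complex.I) • (imPart Z).map Complex.ofReal := by
  ext i j
  have : Z j i = Z i j := congrFun (congrFun hZ i) j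
  simp only [Matrix.sub_apply, conjTranspose_apply, Matrix.smul_apply, map_apply, imPart, this]
  apply Complex.ext <;> simp
  ring

theorem transpose_den_mul_num {n : ℕ} (g : SpZ n) {Z : Matrix (Fin n) (Fin n) ℂ} (hZ : Zᵀ = Z) :
    (blockC g * Z + blockD g)ᵀ * (blockA g * Z + blockB g) =
      (blockA g * Z + blockB g)ᵀ * (blockC g * Z + blockD g) := by
  obtain ⟨h1, h2, h3⟩ := block_relations g
  have h4 := block_relation' g
  rw [← sub_eq_zero]
  simp only [transpose_add, transpose_mul, hZ]
  calc _ = - (Z * ((blockA g)ᵀ * blockC g - (blockC g)ᵀ * blockA g) * Z)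
        - Z * ((blockA g)ᵀ * blockD g - (blockC g)ᵀ * blockB g)
        + ((blockD g)ᵀ * blockA g - (blockB g)ᵀ * blockC g) * Z
        - ((blockB g)ᵀ * blockD g - (blockD g)ᵀ * blockB g) := by noncomm_ring
    _ = 0 := by rw [h1, h2, h3, h4]; simp

theorem conjTranspose_den_mul_num {n : ℕ} (g : SpZ n) {Z : Matrix (Fin n) (Fin n) ℂ} :
    (blockC g * Z + blockD g)ᴴ * (blockA g * Z + blockB g) -
      (blockA g * Z + blockB g)ᴴ * (blockC g * Z + blockD g) = Z - Zᴴ := by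
  obtain ⟨h1, h2, h3⟩ := block_relations g
  have h4 := block_relation' g
  have eA : (blockA g)ᴴ = (blockA g)ᵀ := conjTranspose_map_intCast _
  have eB : (blockB g)ᴴ = (blockB g)ᵀ := conjTranspose_map_intCast _
  have eC : (blockC g)ᴴ = (blockC g)ᵀ := conjTranspose_map_intCast _
  have eD : (blockD g)ᴴ = (blockD g)ᵀ := conjTranspose_map_intCast _
  simp only [conjTranspose_add, conjTranspose_mul, eA, eB, eC, eD]
  calc _ = - (Zᴴ * ((blockA g)ᵀ * blockC g - (blockC g)ᵀ * blockA g) * Z)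
        - Zᴴ * ((blockA g)ᵀ * blockD g - (blockC g)ᵀ * blockB g)
        + ((blockD g)ᵀ * blockA g - (blockB g)ᵀ * blockC g) * Z
        - ((blockB g)ᵀ * blockD g - (blockD g)ᵀ * blockB g) := by noncomm_ring
    _ = Z - Zᴴ := by rw [h1, h2, h3, h4]; simp; abel

/-- A vector in the kernel of `CZ + D` would be isotropic for the positive definite `Y`. -/
theorem autFactor_ne_zero {n : ℕ} (g : SpZ n) {Z : Matrix (Fin n) (Fin n) ℂ}
    (hZ : Z ∈ siegelH n) : autFactor g Z ≠ 0 := by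
  intro h0
  obtain ⟨v, hv, hMv⟩ := Matrix.exists_mulVec_eq_zero_iff.2 h0
  have h := conjTranspose_den_mul_num g (Z := Z)
  rw [sub_conjTranspose_of_symm hZ.1] at h
  have h2 := (posDef_map_ofReal_iff.2 hZ.2).dotProduct_mulVec_pos hv
  have h3 := congrArg (fun A => star v ⬝ᵥ (A *ᵥ v)) h
  have hMv' : star v ᵥ* (blockC g * Z + blockD g)ᴴ = 0 := by
    rw [← star_mulVec, hMv, star_zero]
  simp only [sub_mulVec, ← mulVec_mulVec, hMv, mulVec_zero,
    sub_zero, smul_mulVec, dotProduct_smul, smul_eq_mul] at h3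
  rw [dotProduct_mulVec, hMv', zero_dotProduct] at h3
  have := mul_ne_zero (mul_ne_zero two_ne_zero Complex.I_ne_zero) h2.ne'
  exact this h3.symm

theorem moeb_mul_den {n : ℕ} (g : SpZ n) {Z : Matrix (Fin n) (Fin n) ℂ} (hZ : Z ∈ siegelH n) :
    moeb g Z * (blockC g * Z + blockD g) = blockA g * Z + blockB g := by
  have : IsUnit (blockC g * Z + blockD g).det := (autFactor_ne_zero g hZ).isUnit
  rw [moeb, Matrix.mul_assoc, nonsing_inv_mul _ this, Matrix.mul_one]

theorem transpose_moeb {n : ℕ} (g : SpZ n) {Z : Matrix (Fin n) (Fin n) ℂ} (hZ : Z ∈ siegelH n) :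
    (moeb g Z)ᵀ = moeb g Z := by
  have hu : IsUnit (blockC g * Z + blockD g) :=
    (isUnit_iff_isUnit_det _).2 (autFactor_ne_zero g hZ).isUnit
  have h := transpose_den_mul_num g hZ.1
  rw [← moeb_mul_den g hZ, transpose_mul, Matrix.mul_assoc] at h
  have hu' : IsUnit (blockC g * Z + blockD g)ᵀ := (isUnit_transpose _).2 hu
  exact (hu.mul_right_cancel (hu'.mul_left_cancel h)).symm

/-- The transformation law `Y = Mᴴ · Im(g⟨Z⟩) · M` of the imaginary part, where `M = CZ + D`. -/
theorem imPart_eq_star_mul_imPart_moeb {n : ℕ} (g : SpZ n) {Z : Matrix (Fin n) (Fin n) ℂ}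
    (hZ : Z ∈ siegelH n) :
    (imPart Z).map Complex.ofReal = star (blockC g * Z + blockD g) *
      (imPart (moeb g Z)).map Complex.ofReal * (blockC g * Z + blockD g) := by
  have h := conjTranspose_den_mul_num g (Z := Z)
  rw [← moeb_mul_den g hZ, conjTranspose_mul, sub_conjTranspose_of_symm hZ.1, Matrix.mul_assoc,
    ← Matrix.mul_sub, ← Matrix.sub_mul, sub_conjTranspose_of_symm (transpose_moeb g hZ),
    Matrix.smul_mul, Matrix.mul_smul] at h
  have h2 : (2 * Complex.I) ≠ 0 := mul_ne_zero two_ne_zero Complex.I_ne_zero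
  rw [star_eq_conjTranspose, Matrix.mul_assoc]
  exact (smul_right_injective _ h2 h).symm

theorem moeb_mem {n : ℕ} (g : SpZ n) {Z : Matrix (Fin n) (Fin n) ℂ} (hZ : Z ∈ siegelH n) :
    moeb g Z ∈ siegelH n := by
  refine ⟨transpose_moeb g hZ, ?_⟩
  have hu : IsUnit (blockC g * Z + blockD g) :=
    (isUnit_iff_isUnit_det _).2 (autFactor_ne_zero g hZ).isUnit
  have h := posDef_map_ofReal_iff.2 hZ.2
  rw [imPart_eq_star_mul_imPart_moeb g hZ, hu.posDef_star_left_conjugate_iff] at h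
  exact posDef_map_ofReal_iff.1 h

theorem det_imPart_moeb {n : ℕ} (g : SpZ n) {Z : Matrix (Fin n) (Fin n) ℂ} (hZ : Z ∈ siegelH n) :
    ‖autFactor g Z‖ ^ 2 * (imPart (moeb g Z)).det = (imPart Z).det := by
  have h := congrArg det (imPart_eq_star_mul_imPart_moeb g hZ)
  rw [det_mul, det_mul, star_eq_conjTranspose, det_conjTranspose] at h
  have hdet : ∀ A : Matrix (Fin n) (Fin n) ℝ, (A.map Complex.ofReal).det = (A.det : ℂ) := fun A =>
    ((Complex.ofRealHom).map_det A).symm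
  rw [hdet, hdet, mul_right_comm, RCLike.star_def] at h
  change _ = conj (autFactor g Z) * autFactor g Z * _ at h
  rw [Complex.conj_mul'] at h
  exact_mod_cast h.symm

theorem num_den_mul {n : ℕ} (g h : SpZ n) {Z : Matrix (Fin n) (Fin n) ℂ} (hZ : Z ∈ siegelH n) :
    blockA (g * h) * Z + blockB (g * h) =
      (blockA g * moeb h Z + blockB g) * (blockC h * Z + blockD h) ∧
    blockC (g * h) * Z + blockD (g * h) =
      (blockC g * moeb h Z + blockD g) * (blockC h * Z + blockD h) := by
  obtain ⟨h1, h2, h3, h4⟩ := block_mul g h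
  simp only [add_mul, Matrix.mul_assoc, moeb_mul_den h hZ, h1, h2, h3, h4]
  constructor <;> noncomm_ring

theorem moeb_mul {n : ℕ} (g h : SpZ n) {Z : Matrix (Fin n) (Fin n) ℂ} (hZ : Z ∈ siegelH n) :
    moeb (g * h) Z = moeb g (moeb h Z) := by
  obtain ⟨h1, h2⟩ := num_den_mul g h hZ
  have hu : IsUnit (blockC h * Z + blockD h).det := (autFactor_ne_zero h hZ).isUnit
  rw [moeb, h1, h2, Matrix.mul_inv_rev, Matrix.mul_assoc, ← Matrix.mul_assoc _ _⁻¹ _,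
    mul_nonsing_inv _ hu, Matrix.one_mul]
  rfl

theorem moeb_one {n : ℕ} (Z : Matrix (Fin n) (Fin n) ℂ) : moeb 1 Z = Z := by
  have h := fromBlocks_block (1 : SpZ n)
  rw [Submonoid.coe_one, Matrix.map_one _ Int.cast_zero Int.cast_one, ← fromBlocks_one] at h
  obtain ⟨h1, h2, h3, h4⟩ := fromBlocks_inj.1 h
  simp [moeb, h1, h2, h3, h4]

/-- The invariant square `det(Y)^k |F(Z)|²` of the absolute value of a form of weight `k`. -/
def height {n : ℕ} (k : ℕ) (F : Matrix (Fin n) (Fin n) ℂ → ℂ) (Z : Matrix (Fin n) (Fin n) ℂ) : ℝ :=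
  (imPart Z).det ^ k * ‖F Z‖ ^ 2

theorem height_moeb {n : ℕ} (k : ℕ) (F : Matrix (Fin n) (Fin n) ℂ → ℂ) (g : SpZ n)
    {Z : Matrix (Fin n) (Fin n) ℂ} (hZ : Z ∈ siegelH n) :
    height k F (moeb g Z) = height k (slash k F g) Z := by
  have h0 : ‖autFactor g Z‖ ≠ 0 := norm_ne_zero_iff.2 (autFactor_ne_zero g hZ)
  rw [height, height, slash, ← det_imPart_moeb g hZ, norm_mul, norm_inv, norm_pow,
    mul_pow (‖autFactor g Z‖ ^ 2)]
  field_simp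
  ring

theorem height_nonneg {n : ℕ} (k : ℕ) (F : Matrix (Fin n) (Fin n) ℂ → ℂ)
    {Z : Matrix (Fin n) (Fin n) ℂ} (hZ : Z ∈ siegelH n) : 0 ≤ height k F Z :=
  mul_nonneg (pow_nonneg hZ.2.det_pos.le _) (sq_nonneg _)

/-! ### Reduction of lattice bases -/

/-- Two families of `n` vectors are unimodularly equivalent if the second arises from the first by
a matrix in `GL_n(ℤ)`; invertibility of `U` is recorded by a one-sided inverse. -/
def UnimodularEquiv {E : Type*} [AddCommGroup E] {n : ℕ} (v w : Fin n → E) : Prop :=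
  ∃ U V : Matrix (Fin n) (Fin n) ℤ, U * V = 1 ∧ ∀ i, w i = ∑ j, U i j • v j

theorem UnimodularEquiv.refl {E : Type*} [AddCommGroup E] {n : ℕ} (v : Fin n → E) :
    UnimodularEquiv v v :=
  ⟨1, 1, one_mul 1, fun i => by simp [Matrix.one_apply]⟩

theorem UnimodularEquiv.trans {E : Type*} [AddCommGroup E] {n : ℕ} {u v w : Fin n → E}
    (h₁ : UnimodularEquiv u v) (h₂ : UnimodularEquiv v w) : UnimodularEquiv u w := by
  obtain ⟨U₁, V₁, hUV₁, h₁⟩ := h₁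
  obtain ⟨U₂, V₂, hUV₂, h₂⟩ := h₂
  refine ⟨U₂ * U₁, V₁ * V₂, ?_, fun i => ?_⟩
  · rw [Matrix.mul_assoc, ← Matrix.mul_assoc U₁, hUV₁, Matrix.one_mul, hUV₂]
  · simp only [h₂, h₁, Matrix.mul_apply, Finset.smul_sum, Finset.sum_smul, mul_smul]
    exact Finset.sum_comm

theorem UnimodularEquiv.comp_perm {E : Type*} [AddCommGroup E] {n : ℕ} (v : Fin n → E)
    (σ : Equiv.Perm (Fin n)) : UnimodularEquiv v (v ∘ σ) := by
  refine ⟨(1 : Matrix _ _ ℤ).submatrix σ id, (1 : Matrix _ _ ℤ).submatrix id σ, ?_, fun i => ?_⟩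
  · have h := submatrix_mul_equiv (1 : Matrix (Fin n) (Fin n) ℤ) 1 σ (Equiv.refl _) σ
    simpa using h
  · simp [Matrix.one_apply]

/-- A unimodular change of the last `n` of `n + 1` vectors, followed by adding integral multiples
of the first vector to them, is unimodular. -/
theorem UnimodularEquiv.cons {E : Type*} [AddCommGroup E] {n : ℕ} (v : Fin (n + 1) → E)
    {U V : Matrix (Fin n) (Fin n) ℤ} (h : U * V = 1) (c : Fin n → ℤ) :
    UnimodularEquiv v
      (Fin.cons (v 0) fun i => c i • v 0 + ∑ j, U i j • v j.succ : Fin (n + 1) → E) := by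
  have h' : V * U = 1 := mul_eq_one_comm.1 h
  refine ⟨Matrix.of (Fin.cons (Fin.cons 1 0) fun i => Fin.cons (c i) (U i)),
    Matrix.of (Fin.cons (Fin.cons 1 0) fun i => Fin.cons (-(∑ j, V i j * c j)) (V i)), ?_,
    fun i => ?_⟩
  · refine mul_eq_one_comm.1 ?_
    ext i j
    have hij : ∀ i j : Fin n, ∑ k, V i k * U k j = (1 : Matrix _ _ ℤ) i j := fun i j => by
      rw [← h', Matrix.mul_apply]
    refine Fin.cases ?_ (fun i => ?_) i <;> refine Fin.cases ?_ (fun j => ?_) j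
    · simp [Matrix.mul_apply, Fin.sum_univ_succ]
    · simp [Matrix.mul_apply, Fin.sum_univ_succ, (Fin.succ_ne_zero _).symm]
    · simp [Matrix.mul_apply, Fin.sum_univ_succ]
    · simp [Matrix.mul_apply, Fin.sum_univ_succ, hij, Matrix.one_apply]
  · refine Fin.cases ?_ (fun i => ?_) i <;> simp [Fin.sum_univ_succ]

theorem norm_sq_smul_add_of_inner_eq_zero {E : Type*} [NormedAddCommGroup E]
    [InnerProductSpace ℝ E] (a : ℝ) {u w : E} (h : inner ℝ u w = 0) :
    ‖a • u + w‖ ^ 2 = a ^ 2 * ‖u‖ ^ 2 + ‖w‖ ^ 2 := by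
  rw [norm_add_sq_real, inner_smul_left, h, norm_smul, mul_pow, Real.norm_eq_abs, sq_abs]
  simp

/-- A lattice basis all of whose unimodular transforms consist of vectors of squared length at
least `m` has a transform whose Gram matrix is bounded below by a multiple of `m` depending only
on the rank. The first vector is chosen almost shortest, and induction applies to the projection
of the others to its orthogonal complement. -/
theorem exists_reduced_family {E : Type*} [NormedAddCommGroup E] [InnerProductSpace ℝ E] (n : ℕ) :
    ∃ ε : ℝ, 0 < ε ∧ ∀ (v : Fin n → E) (m : ℝ), 0 < m →
      (∀ w, UnimodularEquiv v w → ∀ i, m ≤ ‖w i‖ ^ 2) →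
      ∃ w, UnimodularEquiv v w ∧
        ∀ x : Fin n → ℝ, ε * m * ∑ i, x i ^ 2 ≤ ‖∑ i, x i • w i‖ ^ 2 := by
  induction n with
  | zero => exact ⟨1, one_pos, fun v m _ _ => ⟨v, .refl v, fun x => by simp⟩⟩
  | succ n ih =>
    obtain ⟨ε, hε, ih⟩ := ih
    -- The constant comes from `x₀² + q ≤ 2 (x₀ + p)² + (n / 2 + 1) q`, where `q` is the squared
    -- length of the remaining coordinates and `p² ≤ q n / 4`, and from induction with `m / 2`.
    refine ⟨min (1 / 2) (ε / (2 * (n / 2 + 1))), by positivity, fun v m hm hv => ?_⟩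
    set S : Set ℝ := {t | ∃ w, UnimodularEquiv v w ∧ t = ‖w 0‖ ^ 2} with hS
    have hSne : S.Nonempty := ⟨_, v, .refl v, rfl⟩
    have hSm : ∀ t ∈ S, m ≤ t := by
      rintro t ⟨w, hw, rfl⟩
      exact hv w hw 0
    have hms : m ≤ sInf S := le_csInf hSne hSm
    obtain ⟨t, ⟨w, hw, rfl⟩, hlt⟩ := exists_lt_of_csInf_lt hSne
      (show sInf S < 2 * sInf S by linarith)
    have hmin : ∀ w', UnimodularEquiv v w' → ∀ i, sInf S ≤ ‖w' i‖ ^ 2 := fun w' hw' i =>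
      csInf_le ⟨m, hSm⟩ ⟨_, hw'.trans (.comp_perm w' (Equiv.swap 0 i)), by simp⟩
    have hv0 : 0 < ‖w 0‖ ^ 2 := hm.trans_le (hv w hw 0)
    set b : Fin n → ℝ := fun j => inner ℝ (w 0) (w j.succ) / ‖w 0‖ ^ 2 with hb
    set v' : Fin n → E := fun j => w j.succ - b j • w 0 with hv'
    have horth : ∀ j, inner ℝ (w 0) (v' j) = 0 := fun j => by
      simp only [hv', hb, inner_sub_right, inner_smul_right, real_inner_self_eq_norm_sq]
      rw [div_mul_cancel₀ _ hv0.ne', sub_self]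
    -- A unimodular transform of the projected family lifts, with coefficients along the first
    -- vector of absolute value at most `1/2`.
    have hlift : ∀ w', UnimodularEquiv v' w' → (∀ i, inner ℝ (w 0) (w' i) = 0) ∧
        ∃ s : Fin n → ℝ, (∀ i, s i ^ 2 ≤ 1 / 4) ∧
          UnimodularEquiv v (Fin.cons (w 0) fun i => s i • w 0 + w' i : Fin (n + 1) → E) := by
      rintro w' ⟨U, V, hUV, hw'⟩
      refine ⟨fun i => by
        simp [hw', inner_sum, ← Int.cast_smul_eq_zsmul ℝ, inner_smul_right, horth], ?_⟩
      refine ⟨fun i => (∑ j, U i j * b j) - round (∑ j, U i j * b j), fun i => ?_, ?_⟩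
      · have := abs_sub_round (∑ j, U i j * b j)
        rw [← sq_abs]
        nlinarith [abs_nonneg ((∑ j, U i j * b j) - round (∑ j, U i j * b j))]
      · have := hw.trans (.cons w hUV fun i => -round (∑ j, U i j * b j))
        convert this using 3 with i
        rw [hw' i]
        simp only [hv', smul_sub, Finset.sum_sub_distrib, sub_smul,
          ← Int.cast_smul_eq_zsmul ℝ, smul_smul, ← Finset.sum_smul, Int.cast_neg, neg_smul]
        abel
    obtain ⟨w', hw', hred⟩ := ih v' (m / 2) (by positivity) fun w' hw' i => by
      obtain ⟨ho, s, hs, hequiv⟩ := hlift w' hw'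
      have h := hmin _ hequiv i.succ
      simp only [Fin.cons_succ] at h
      rw [norm_sq_smul_add_of_inner_eq_zero _ (ho i)] at h
      nlinarith [hs i, mul_le_mul_of_nonneg_right (hs i) hv0.le]
    obtain ⟨ho, s, hs, hequiv⟩ := hlift w' hw'
    refine ⟨_, hequiv, fun x => ?_⟩
    set p := ∑ i : Fin n, x i.succ * s i with hp
    set q := ∑ i : Fin n, x i.succ ^ 2 with hq
    have hq0 : 0 ≤ q := Finset.sum_nonneg fun i _ => sq_nonneg _
    have hpq : p ^ 2 ≤ q * (n / 4) := by
      refine (Finset.sum_mul_sq_le_sq_mul_sq _ _ _).trans (mul_le_mul_of_nonneg_left ?_ hq0)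
      refine (Finset.sum_le_sum fun i _ => hs i).trans (le_of_eq ?_)
      simp
      ring
    have hsum : ∑ i, x i • (Fin.cons (w 0) fun i => s i • w 0 + w' i : Fin (n + 1) → E) i =
        (x 0 + p) • w 0 + ∑ i : Fin n, x i.succ • w' i := by
      simp only [Fin.sum_univ_succ, Fin.cons_zero, Fin.cons_succ, smul_add, smul_smul,
        Finset.sum_add_distrib, ← Finset.sum_smul, add_smul, hp]
      abel
    have ho' : inner ℝ (w 0) (∑ i : Fin n, x i.succ • w' i) = 0 := by
      simp [inner_sum, inner_smul_right, ho]
    rw [hsum, norm_sq_smul_add_of_inner_eq_zero _ ho', Fin.sum_univ_succ]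
    have h1 := hred fun i => x i.succ
    have h2 := hv w hw 0
    set δ := min (1 / 2) (ε / (2 * ((n : ℝ) / 2 + 1))) with hδ
    have hδ0 : 0 < δ := by positivity
    have hδ1 : δ ≤ 1 / 2 := min_le_left _ _
    have hδ2 : δ * (n / 2 + 1) ≤ ε / 2 := by
      have : δ ≤ ε / (2 * ((n : ℝ) / 2 + 1)) := min_le_right _ _
      rw [le_div_iff₀ (by positivity)] at this
      linarith
    have h3 : x 0 ^ 2 + q ≤ 2 * (x 0 + p) ^ 2 + (n / 2 + 1) * q := by
      nlinarith [sq_nonneg (x 0 + 2 * p)]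
    calc δ * m * (x 0 ^ 2 + q) ≤ δ * m * (2 * (x 0 + p) ^ 2 + (n / 2 + 1) * q) := by gcongr
      _ = 2 * δ * (x 0 + p) ^ 2 * m + δ * (n / 2 + 1) * (m * q) := by ring
      _ ≤ 1 * (x 0 + p) ^ 2 * m + ε / 2 * (m * q) := by
        gcongr
        linarith
      _ ≤ (x 0 + p) ^ 2 * ‖w 0‖ ^ 2 + ‖∑ i : Fin n, x i.succ • w' i‖ ^ 2 := by
        have : (x 0 + p) ^ 2 * m ≤ (x 0 + p) ^ 2 * ‖w 0‖ ^ 2 := by gcongr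
        linarith

/-! ### The height `det Im(g⟨Z⟩)` is bounded on modular orbits -/

theorem one_le_det_of_posSemidef_sub_one {ι : Type*} [Fintype ι] [DecidableEq ι]
    {A : Matrix ι ι ℝ} (hA : (A - 1).PosSemidef) : 1 ≤ A.det := by
  have hA' : A.IsHermitian := by simpa using hA.isHermitian.add (isHermitian_one (n := ι) (α := ℝ))
  rw [hA'.det_eq_prod_eigenvalues]
  rw [← Finset.prod_const_one (s := Finset.univ (α := ι))]
  refine Finset.prod_le_prod (fun _ _ => zero_le_one) fun i _ => ?_
  have hv := hA'.mulVec_eigenvectorBasis i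
  set v : ι → ℝ := (hA'.eigenvectorBasis i).ofLp with hv'
  have h1 := hA.dotProduct_mulVec_nonneg v
  have hvne : v ≠ 0 := fun h0 =>
    hA'.eigenvectorBasis.toBasis.ne_zero i (by ext j; simpa using congrFun h0 j)
  have hpos : 0 < star v ⬝ᵥ v := dotProduct_star_self_pos_iff.2 hvne
  rw [sub_mulVec, hv, one_mulVec, dotProduct_sub, dotProduct_smul, smul_eq_mul] at h1
  by_contra! hlt
  simp only [RCLike.ofReal_real_eq_id, id] at hlt
  nlinarith

theorem det_le_det_of_posSemidef_sub {ι : Type*} [Fintype ι] [DecidableEq ι]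
    {A B : Matrix ι ι ℝ} (hA : A.PosDef) (h : (B - A).PosSemidef) : A.det ≤ B.det := by
  obtain ⟨S, hS, rfl⟩ := exists_conjTranspose_mul_self_of_posDef hA
  have hdet : IsUnit S.det := (isUnit_iff_isUnit_det _).1 hS
  have hdet' : IsUnit Sᵀ.det := by rwa [det_transpose]
  have h1 := h.conjTranspose_mul_mul_same S⁻¹
  rw [conjTranspose_eq_transpose_of_trivial, Matrix.mul_sub, Matrix.sub_mul] at h1
  have h2 : S⁻¹ᵀ * (Sᵀ * S) * S⁻¹ = 1 := by
    rw [Matrix.mul_assoc, Matrix.mul_assoc, mul_nonsing_inv _ hdet, Matrix.mul_one,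
      ← transpose_mul, mul_nonsing_inv _ hdet, transpose_one]
  rw [h2] at h1
  have h3 := one_le_det_of_posSemidef_sub_one h1
  rw [det_mul, det_mul, det_transpose, det_nonsing_inv] at h3
  rw [det_mul, det_transpose]
  rw [Ring.inverse_eq_inv] at h3
  have h5 : 0 < S.det * S.det := mul_self_pos.2 hdet.ne_zero
  calc S.det * S.det = S.det * S.det * 1 := (mul_one _).symm
    _ ≤ S.det * S.det * (S.det⁻¹ * B.det * S.det⁻¹) := by gcongr
    _ = B.det := by field_simp [hdet.ne_zero]

theorem dotProduct_mulVec_self_le {ι κ : Type*} [Fintype ι] [Fintype κ]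
    (C : Matrix ι κ ℝ) (y : κ → ℝ) :
    (C *ᵥ y) ⬝ᵥ (C *ᵥ y) ≤ (∑ i, ∑ j, C i j ^ 2) * (y ⬝ᵥ y) := by
  simp only [dotProduct, mulVec, ← pow_two, Finset.sum_mul]
  refine Finset.sum_le_sum fun i _ => ?_
  rw [← Finset.sum_mul]
  exact Finset.sum_mul_sq_le_sq_mul_sq _ _ _

theorem dotProduct_self_nonneg_real {ι : Type*} [Fintype ι] (y : ι → ℝ) : 0 ≤ y ⬝ᵥ y :=
  Finset.sum_nonneg fun _ _ => mul_self_nonneg _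

theorem dotProduct_sub_self_le {ι : Type*} [Fintype ι] (y z : ι → ℝ) :
    (y - z) ⬝ᵥ (y - z) ≤ 2 * (y ⬝ᵥ y) + 2 * (z ⬝ᵥ z) := by
  simp only [dotProduct, Finset.mul_sum, ← Finset.sum_add_distrib]
  refine Finset.sum_le_sum fun i _ => ?_
  simp only [Pi.sub_apply]
  nlinarith [sq_nonneg (y i + z i)]

/-- The lower left block of `g` as a real matrix. -/
def realC {n : ℕ} (g : SpZ n) : Matrix (Fin n) (Fin n) ℝ :=
  (g : Matrix (Fin n ⊕ Fin n) (Fin n ⊕ Fin n) ℤ).toBlocks₂₁.map (Int.cast : ℤ → ℝ)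

/-- The lower right block of `g` as a real matrix. -/
def realD {n : ℕ} (g : SpZ n) : Matrix (Fin n) (Fin n) ℝ :=
  (g : Matrix (Fin n ⊕ Fin n) (Fin n ⊕ Fin n) ℤ).toBlocks₂₂.map (Int.cast : ℤ → ℝ)

theorem map_realC {n : ℕ} (g : SpZ n) : (realC g).map Complex.ofReal = blockC g := by
  ext i j
  simp [realC, blockC]

theorem map_realD {n : ℕ} (g : SpZ n) : (realD g).map Complex.ofReal = blockD g := by
  ext i j
  simp [realD, blockD]

/-- The relations between the rows of a symplectic matrix. -/
theorem int_row_relations {n : ℕ} (g : SpZ n) :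
    g.1.toBlocks₂₁ * g.1.toBlocks₂₂ᵀ = g.1.toBlocks₂₂ * g.1.toBlocks₂₁ᵀ ∧
    g.1.toBlocks₁₁ * g.1.toBlocks₂₂ᵀ - g.1.toBlocks₁₂ * g.1.toBlocks₂₁ᵀ = 1 := by
  have h := SymplecticGroup.transpose_mem g.2
  rw [← fromBlocks_toBlocks g.1, fromBlocks_transpose, SymplecticGroup.fromBlocks_mem_iff] at h
  simpa using h.2

theorem realC_mul_realD {n : ℕ} (g : SpZ n) :
    realC g * (realD g)ᵀ = realD g * (realC g)ᵀ := by
  have := congrArg (Int.castRingHom ℝ).mapMatrix (int_row_relations g).1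
  simp only [map_mul, RingHom.mapMatrix_apply, transpose_map] at this
  exact this

/-- The Gram determinant of the `n` lower rows of `g` is a positive integer. -/
theorem gram_posDef {n : ℕ} (g : SpZ n) :
    (realC g * (realC g)ᵀ + realD g * (realD g)ᵀ).PosDef ∧
      1 ≤ (realC g * (realC g)ᵀ + realD g * (realD g)ᵀ).det := by
  have hpos : (realC g * (realC g)ᵀ + realD g * (realD g)ᵀ).PosDef := by
    have h1 := (posSemidef_self_mul_conjTranspose (realC g)).add
      (posSemidef_self_mul_conjTranspose (realD g))
    simp only [conjTranspose_eq_transpose_of_trivial] at h1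
    refine .of_dotProduct_mulVec_pos h1.isHermitian fun w hw => ?_
    have e : star w ⬝ᵥ ((realC g * (realC g)ᵀ + realD g * (realD g)ᵀ) *ᵥ w) =
        ((realC g)ᵀ *ᵥ w) ⬝ᵥ ((realC g)ᵀ *ᵥ w) + ((realD g)ᵀ *ᵥ w) ⬝ᵥ ((realD g)ᵀ *ᵥ w) := by
      simp only [star_trivial, add_mulVec, dotProduct_add, ← mulVec_mulVec, dotProduct_mulVec,
        ← mulVec_transpose]
    rw [e]
    by_contra! hle
    have hC := dotProduct_self_nonneg_real ((realC g)ᵀ *ᵥ w)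
    have hD := dotProduct_self_nonneg_real ((realD g)ᵀ *ᵥ w)
    have hC0 : (realC g)ᵀ *ᵥ w = 0 := dotProduct_self_eq_zero.1 (by linarith)
    have hD0 : (realD g)ᵀ *ᵥ w = 0 := dotProduct_self_eq_zero.1 (by linarith)
    have h2 := congrArg (Int.castRingHom ℝ).mapMatrix (int_row_relations g).2
    simp only [map_sub, map_mul, map_one, RingHom.mapMatrix_apply, transpose_map] at h2
    have h3 : g.1.toBlocks₁₁.map (Int.cast : ℤ → ℝ) * (realD g)ᵀ -
        g.1.toBlocks₁₂.map (Int.cast : ℤ → ℝ) * (realC g)ᵀ = 1 := h2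
    have h4 := congrArg (· *ᵥ w) h3
    simp only [sub_mulVec, ← mulVec_mulVec, hC0, hD0, mulVec_zero, sub_zero, one_mulVec] at h4
    exact hw h4.symm
  refine ⟨hpos, ?_⟩
  have e : realC g * (realC g)ᵀ + realD g * (realD g)ᵀ = (Int.castRingHom ℝ).mapMatrix
      (g.1.toBlocks₂₁ * g.1.toBlocks₂₁ᵀ + g.1.toBlocks₂₂ * g.1.toBlocks₂₂ᵀ) := by
    simp only [map_add, map_mul, RingHom.mapMatrix_apply, transpose_map]
    rfl
  have h := hpos.det_pos
  rw [e, ← RingHom.map_det] at h ⊢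
  simp only [Int.coe_castRingHom] at h ⊢
  exact_mod_cast h

/-- The inverse of `Im(g⟨Z⟩)`, as a real matrix: for `Z = X + iY` it is
`(CX + D) Y⁻¹ (CX + D)ᵀ + C Y Cᵀ`. -/
theorem imPart_moeb_mul {n : ℕ} (g : SpZ n) {Z : Matrix (Fin n) (Fin n) ℂ} (hZ : Z ∈ siegelH n) :
    imPart (moeb g Z) * ((realC g * Z.map Complex.re + realD g) * (imPart Z)⁻¹ *
      (realC g * Z.map Complex.re + realD g)ᵀ + realC g * imPart Z * (realC g)ᵀ) = 1 := by
  have hsymm : ∀ i j, Z i j = Z j i := fun i j => congrFun (congrFun hZ.1 j) i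
  have hXt : (Z.map Complex.re)ᵀ = Z.map Complex.re := by
    ext i j
    simp [hsymm i j]
  have hYt : (imPart Z)ᵀ = imPart Z := by
    ext i j
    simp [imPart, hsymm i j]
  have hYu : IsUnit (imPart Z).det := (isUnit_iff_isUnit_det _).1 hZ.2.isUnit
  have hCD := realC_mul_realD g
  have hkey := imPart_eq_star_mul_imPart_moeb g hZ
  have hMu : IsUnit (blockC g * Z + blockD g) :=
    (isUnit_iff_isUnit_det _).2 (autFactor_ne_zero g hZ).isUnit
  set φ := Complex.ofRealHom.mapMatrix (m := Fin n) with hφ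
  have hφa : ∀ A, A.map Complex.ofReal = φ A := fun A => rfl
  set X := Z.map Complex.re
  set Y := imPart Z with hY
  set C := realC g
  set D := realD g
  set V := imPart (moeb g Z)
  have hZXY : Z = φ X + Complex.I • φ Y := by
    ext i j
    simp [hφ, X, Y, imPart, mul_comm Complex.I, Complex.re_add_im]
  have hM : blockC g * Z + blockD g = φ (C * X + D) + Complex.I • φ (C * Y) := by
    rw [← map_realC, ← map_realD, hφa, hφa, hZXY]
    simp only [map_add, map_mul, Matrix.mul_add, Matrix.mul_smul]
    abel
  have hMs : star (blockC g * Z + blockD g) = φ (C * X + D)ᵀ - Complex.I • φ (C * Y)ᵀ := by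
    have hφs : ∀ A, (φ A)ᴴ = φ Aᵀ := fun A => by
      ext i j
      simp [hφ]
    rw [hM, star_eq_conjTranspose, conjTranspose_add, conjTranspose_smul, hφs, hφs,
      Complex.star_def, Complex.conj_I, neg_smul, sub_eq_add_neg]
  have h1 : φ V * ((blockC g * Z + blockD g) * φ Y⁻¹ * star (blockC g * Z + blockD g)) = 1 := by
    refine (hMu.star).mul_left_cancel ?_
    have h2 : φ Y * φ Y⁻¹ = 1 := by rw [← map_mul, mul_nonsing_inv _ hYu, map_one]
    rw [mul_one]
    calc _ = (star (blockC g * Z + blockD g) * φ V * (blockC g * Z + blockD g)) * φ Y⁻¹ *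
          star (blockC g * Z + blockD g) := by simp only [Matrix.mul_assoc]
      _ = star (blockC g * Z + blockD g) := by
        rw [← hφa V, ← hkey, hφa, h2, Matrix.one_mul]
  have h2 : (blockC g * Z + blockD g) * φ Y⁻¹ * star (blockC g * Z + blockD g) =
      φ ((C * X + D) * Y⁻¹ * (C * X + D)ᵀ + C * Y * Cᵀ) := by
    have e1 : Y * Y⁻¹ = 1 := mul_nonsing_inv _ hYu
    have e2 : Y⁻¹ * Y = 1 := nonsing_inv_mul _ hYu
    rw [hMs, hM]
    calc _ = φ ((C * X + D) * Y⁻¹ * (C * X + D)ᵀ) -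
          (Complex.I * Complex.I) • φ (C * Y * Y⁻¹ * (C * Y)ᵀ) +
          Complex.I • φ (C * Y * Y⁻¹ * (C * X + D)ᵀ - (C * X + D) * Y⁻¹ * (C * Y)ᵀ) := by
          generalize C * X + D = P
          generalize C * Y = Q
          simp only [map_mul, map_sub, Matrix.add_mul, Matrix.mul_sub, Matrix.smul_mul,
            Matrix.mul_smul, smul_sub, smul_smul, smul_add]
          abel
      _ = _ := by
        have e3 : C * Y * Y⁻¹ * (C * X + D)ᵀ - (C * X + D) * Y⁻¹ * (C * Y)ᵀ = 0 := by
          rw [Matrix.mul_assoc C Y, e1, transpose_mul, hYt, Matrix.mul_assoc _ Y⁻¹,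
            ← Matrix.mul_assoc Y⁻¹, e2, transpose_add, transpose_mul, hXt]
          simp only [Matrix.mul_one, Matrix.one_mul, Matrix.mul_add, Matrix.add_mul, hCD,
            Matrix.mul_assoc]
          abel
        have e4 : C * Y * Y⁻¹ * (C * Y)ᵀ = C * Y * Cᵀ := by
          rw [Matrix.mul_assoc C Y, e1, Matrix.mul_one, transpose_mul, hYt, Matrix.mul_assoc]
        rw [e3, e4, Complex.I_mul_I, map_zero, smul_zero, add_zero, map_add, neg_smul, one_smul,
          sub_neg_eq_add]
  rw [h2, ← map_mul] at h1
  have h3 : Function.Injective φ := fun A B hAB => by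
    ext i j
    have := congrFun (congrFun hAB i) j
    simpa [hφ] using this
  exact h3 (h1.trans (map_one φ).symm)

/-- The inverse `T` of `Im(g⟨Z⟩)` is the Gram matrix of the rows of `(C D)` for a positive definite
form depending only on `Z`, hence is bounded below by a multiple of the Euclidean Gram matrix. -/
theorem exists_smul_gram_le {n : ℕ} {Z : Matrix (Fin n) (Fin n) ℂ} (hZ : Z ∈ siegelH n) :
    ∃ c : ℝ, 0 < c ∧ ∀ g : SpZ n, ∃ T : Matrix (Fin n) (Fin n) ℝ, imPart (moeb g Z) * T = 1 ∧
      (T - c⁻¹ • (realC g * (realC g)ᵀ + realD g * (realD g)ᵀ)).PosSemidef := by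
  obtain ⟨B, hB, hBY⟩ := exists_conjTranspose_mul_self_of_posDef hZ.2
  have hBd : IsUnit B.det := (isUnit_iff_isUnit_det _).1 hB
  have hXt : (Z.map Complex.re)ᵀ = Z.map Complex.re := by
    ext i j
    simpa using congrArg Complex.re (congrFun (congrFun hZ.1 i) j)
  set X := Z.map Complex.re with hX
  set β := ∑ i, ∑ j, B⁻¹ i j ^ 2 with hβ
  set γ := ∑ i, ∑ j, Bᵀ i j ^ 2 with hγ
  set ξ := ∑ i, ∑ j, X i j ^ 2 with hξ
  have hβ0 : 0 ≤ β := by positivity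
  have hγ0 : 0 ≤ γ := by positivity
  have hξ0 : 0 ≤ ξ := by positivity
  set c := β + 2 * (ξ * β) + 2 * γ + 1 with hc
  have hc0 : 0 < c := by positivity
  refine ⟨c, hc0, fun g => ?_⟩
  set C := realC g with hC
  set D := realD g with hD
  set T := (C * X + D) * (imPart Z)⁻¹ * (C * X + D)ᵀ + C * imPart Z * Cᵀ with hT
  have hVT : imPart (moeb g Z) * T = 1 := imPart_moeb_mul g hZ
  -- With `Y = BᵀB` the form is `|B p|² + |B⁻ᵀ (X p + q)|²` in `p = Cᵀw` and `q = Dᵀw`.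
  have hTq : ∀ w, w ⬝ᵥ (T *ᵥ w) = (B *ᵥ (Cᵀ *ᵥ w)) ⬝ᵥ (B *ᵥ (Cᵀ *ᵥ w)) +
      (B⁻¹ᵀ *ᵥ (X *ᵥ (Cᵀ *ᵥ w) + Dᵀ *ᵥ w)) ⬝ᵥ (B⁻¹ᵀ *ᵥ (X *ᵥ (Cᵀ *ᵥ w) + Dᵀ *ᵥ w)) := fun w => by
    have e : T = (B⁻¹ᵀ * (X * Cᵀ + Dᵀ))ᵀ * (B⁻¹ᵀ * (X * Cᵀ + Dᵀ)) + (B * Cᵀ)ᵀ * (B * Cᵀ) := by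
      simp only [hT, hBY, Matrix.mul_inv_rev, transpose_mul, transpose_add, transpose_transpose,
        hXt, transpose_nonsing_inv, Matrix.mul_assoc]
    have e2 : X *ᵥ (Cᵀ *ᵥ w) + Dᵀ *ᵥ w = (X * Cᵀ + Dᵀ) *ᵥ w := by
      rw [add_mulVec, mulVec_mulVec]
    rw [e, e2, add_mulVec, dotProduct_add, ← mulVec_mulVec, dotProduct_mulVec, vecMul_transpose,
      ← mulVec_mulVec w (B * Cᵀ)ᵀ, dotProduct_mulVec w (B * Cᵀ)ᵀ, vecMul_transpose]
    simp only [mulVec_mulVec]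
    rw [add_comm]
  refine ⟨T, hVT, ?_⟩
  refine .of_dotProduct_mulVec_nonneg ?_ fun w => ?_
  · have hTt : Tᵀ = T := by
      simp only [hT, hBY, transpose_add, transpose_mul, transpose_transpose, Matrix.mul_inv_rev,
        transpose_nonsing_inv, Matrix.mul_assoc]
    rw [IsHermitian, conjTranspose_eq_transpose_of_trivial, transpose_sub, hTt, transpose_smul]
    simp [transpose_mul]
  · have e : star w ⬝ᵥ ((T - c⁻¹ • (C * Cᵀ + D * Dᵀ)) *ᵥ w) = w ⬝ᵥ (T *ᵥ w) -
        c⁻¹ * ((Cᵀ *ᵥ w) ⬝ᵥ (Cᵀ *ᵥ w) + (Dᵀ *ᵥ w) ⬝ᵥ (Dᵀ *ᵥ w)) := by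
      simp only [star_trivial, sub_mulVec, dotProduct_sub, smul_mulVec, dotProduct_smul,
        smul_eq_mul, add_mulVec, dotProduct_add, ← mulVec_mulVec, dotProduct_mulVec,
        ← mulVec_transpose]
    rw [e, hTq, sub_nonneg, inv_mul_le_iff₀ hc0]
    set p := Cᵀ *ᵥ w
    set q := Dᵀ *ᵥ w
    set a := B *ᵥ p with ha
    set r := B⁻¹ᵀ *ᵥ (X *ᵥ p + q) with hr
    have hp : p = B⁻¹ *ᵥ a := by
      rw [ha, mulVec_mulVec, nonsing_inv_mul _ hBd, one_mulVec]
    have hq : q = Bᵀ *ᵥ r - X *ᵥ p := by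
      rw [hr, mulVec_mulVec, ← transpose_mul, nonsing_inv_mul _ hBd, transpose_one, one_mulVec]
      abel
    have h1 : p ⬝ᵥ p ≤ β * (a ⬝ᵥ a) := by
      rw [hp]
      exact dotProduct_mulVec_self_le _ _
    have h2 : q ⬝ᵥ q ≤ 2 * (γ * (r ⬝ᵥ r)) + 2 * (ξ * (p ⬝ᵥ p)) := by
      rw [hq]
      refine (dotProduct_sub_self_le _ _).trans ?_
      gcongr
      · exact dotProduct_mulVec_self_le _ _
      · exact dotProduct_mulVec_self_le _ _
    have h3 : ξ * (p ⬝ᵥ p) ≤ ξ * (β * (a ⬝ᵥ a)) := by gcongr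
    have ha0 := dotProduct_self_nonneg_real a
    have hr0 := dotProduct_self_nonneg_real r
    have h4 : 0 ≤ β * (r ⬝ᵥ r) := by positivity
    have h5 : 0 ≤ ξ * β * (r ⬝ᵥ r) := by positivity
    have h6 : 0 ≤ γ * (a ⬝ᵥ a) := by positivity
    rw [hc]
    nlinarith

theorem exists_det_imPart_moeb_le {n : ℕ} {Z : Matrix (Fin n) (Fin n) ℂ} (hZ : Z ∈ siegelH n) :
    ∃ K : ℝ, ∀ g : SpZ n, (imPart (moeb g Z)).det ≤ K := by
  obtain ⟨c, hc0, hc⟩ := exists_smul_gram_le hZ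
  refine ⟨c ^ n, fun g => ?_⟩
  obtain ⟨T, hVT, hpsd⟩ := hc g
  obtain ⟨hG, hG1⟩ := gram_posDef g
  have hdet := det_le_det_of_posSemidef_sub (hG.smul (inv_pos.2 hc0)) hpsd
  rw [det_smul, Fintype.card_fin] at hdet
  have h1 := congrArg det hVT
  rw [det_mul, det_one] at h1
  have hV := (moeb_mem g hZ).2.det_pos
  have h2 : (c⁻¹) ^ n ≤ T.det := le_trans (le_mul_of_one_le_right (by positivity) hG1) hdet
  have h3 := mul_le_mul_of_nonneg_left h2 hV.le
  rwa [h1, inv_pow, ← div_eq_mul_inv, div_le_one (by positivity)] at h3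

/-! ### A weak fundamental domain for the modular group -/

/-- The symplectic matrix `(U 0; 0 U⁻ᵀ)` attached to `U ∈ GL_n(ℤ)` with inverse `V`. -/
def levi {n : ℕ} (U V : Matrix (Fin n) (Fin n) ℤ) (h : U * V = 1) : SpZ n :=
  ⟨fromBlocks U 0 0 Vᵀ, SymplecticGroup.fromBlocks_mem_iff.2 ⟨by simp, by simp, by
    rw [← transpose_mul, mul_eq_one_comm.1 h]; simp⟩⟩

theorem partialInversion_mem {n : ℕ} (i : Fin n) (s : ℤ) :
    fromBlocks (1 - single i i 1) (-single i i 1) (single i i 1)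
      (1 - single i i 1 + s • single i i 1) ∈ symplecticGroup (Fin n) ℤ := by
  rw [SymplecticGroup.fromBlocks_mem_iff]
  have hE : single i i (1 : ℤ) * single i i 1 = single i i 1 := by simp
  have ht : (single i i (1 : ℤ))ᵀ = single i i 1 := by simp
  simp only [transpose_sub, transpose_one, ht, transpose_add, transpose_neg, transpose_smul,
    Matrix.sub_mul, Matrix.mul_sub, hE, Matrix.one_mul, Matrix.mul_one, Matrix.add_mul,
    Matrix.mul_add, Matrix.neg_mul, Matrix.mul_neg, Matrix.smul_mul, Matrix.mul_smul]
  refine ⟨trivial, ?_, ?_⟩ <;> module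

/-- The symplectic matrix acting on the `i`-th diagonal entry of `Z` by `z ↦ -1 / (z + s)` when
the other entries of its row vanish. -/
def partialInversion {n : ℕ} (i : Fin n) (s : ℤ) : SpZ n :=
  ⟨_, partialInversion_mem i s⟩

theorem imPart_moeb_levi {n : ℕ} {U V : Matrix (Fin n) (Fin n) ℤ} (h : U * V = 1)
    (Z : Matrix (Fin n) (Fin n) ℂ) :
    imPart (moeb (levi U V h) Z) =
      U.map (Int.cast : ℤ → ℝ) * imPart Z * (U.map (Int.cast : ℤ → ℝ))ᵀ := by
  have e1 : moeb (levi U V h) Z =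
      U.map (Int.cast : ℤ → ℂ) * Z * (U.map (Int.cast : ℤ → ℂ))ᵀ := by
    have hA : blockA (levi U V h) = U.map (Int.cast : ℤ → ℂ) := rfl
    have hB : blockB (levi U V h) = 0 := by ext i j; simp [blockB, levi]
    have hC : blockC (levi U V h) = 0 := by ext i j; simp [blockC, levi]
    have hD : blockD (levi U V h) = (V.map (Int.cast : ℤ → ℂ))ᵀ := rfl
    have hinv : ((V.map (Int.cast : ℤ → ℂ))ᵀ)⁻¹ = (U.map (Int.cast : ℤ → ℂ))ᵀ := by
      refine inv_eq_right_inv ?_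
      have := congrArg (Int.castRingHom ℂ).mapMatrix h
      simp only [map_mul, map_one, RingHom.mapMatrix_apply] at this
      rw [← transpose_mul]
      exact (congrArg transpose this).trans transpose_one
    rw [moeb, hA, hB, hC, hD, Matrix.zero_mul, zero_add, add_zero, hinv]
  rw [e1]
  ext i j
  simp [imPart, Matrix.mul_apply, Complex.im_sum, Complex.mul_im]

theorem autFactor_partialInversion {n : ℕ} (i : Fin n) (s : ℤ) (Z : Matrix (Fin n) (Fin n) ℂ) :
    autFactor (partialInversion i s) Z = Z i i + s := by
  have hC : blockC (partialInversion i s) = single i i 1 := by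
    ext a b
    simp [blockC, partialInversion, single_apply, apply_ite (Int.cast : ℤ → ℂ)]
  have hD : blockD (partialInversion i s) = 1 - single i i 1 + (s : ℂ) • single i i 1 := by
    ext a b
    simp [blockD, partialInversion, single_apply, Matrix.one_apply,
      apply_ite (Int.cast : ℤ → ℂ)]
  have e : single i i 1 * Z + (1 - single i i 1 + (s : ℂ) • single i i 1) =
      (1 : Matrix (Fin n) (Fin n) ℂ).updateRow i (Z i + Pi.single i (s : ℂ)) := by
    ext a b
    rcases eq_or_ne a i with rfl | ha
    · rcases eq_or_ne a b with rfl | hb <;> simp [*]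
    · simp [ha, ha.symm, Matrix.one_apply]
  rw [autFactor, hC, hD, e, ← cramer_transpose_apply, transpose_one, cramer_one]
  simp

/-- The vectors given by the columns of a matrix `B` have Gram matrix `BᵀB`. -/
theorem norm_sq_sum_smul_columns {n : ℕ} (B : Matrix (Fin n) (Fin n) ℝ) (x : Fin n → ℝ) :
    ‖∑ j, x j • WithLp.toLp 2 (fun a => B a j)‖ ^ 2 = x ⬝ᵥ ((Bᵀ * B) *ᵥ x) := by
  rw [EuclideanSpace.norm_sq_eq, ← mulVec_mulVec, dotProduct_mulVec, vecMul_transpose]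
  simp [dotProduct, mulVec, pow_two, mul_comm]

/-- Every modular orbit meets the set `Y ≥ ε`, for some `ε > 0` depending only on the degree. -/
theorem exists_moeb_imPart_ge (n : ℕ) : ∃ ε : ℝ, 0 < ε ∧ ∀ Z ∈ siegelH n, ∃ g : SpZ n,
    (imPart (moeb g Z) - ε • (1 : Matrix (Fin n) (Fin n) ℝ)).PosSemidef := by
  obtain ⟨ε, hε, hred⟩ := exists_reduced_family (E := EuclideanSpace ℝ (Fin n)) n
  refine ⟨ε * (1 / 2), by positivity, fun Z hZ => ?_⟩
  -- Choose a point of the orbit at which the height is at least half its supremum.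
  obtain ⟨K, hK⟩ := exists_det_imPart_moeb_le hZ
  have hbdd : BddAbove (Set.range fun g : SpZ n => (imPart (moeb g Z)).det) := by
    refine ⟨K, ?_⟩
    rintro _ ⟨g, rfl⟩
    exact hK g
  set σ := ⨆ g : SpZ n, (imPart (moeb g Z)).det with hσ
  have hle : ∀ g : SpZ n, (imPart (moeb g Z)).det ≤ σ := fun g => le_ciSup hbdd g
  have hσ0 : 0 < σ := (moeb_mem 1 hZ).2.det_pos.trans_le (hle 1)
  obtain ⟨g₀, hg₀⟩ := exists_lt_of_lt_ciSup (show σ / 2 < σ by linarith)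
  set W := moeb g₀ Z with hW
  have hWm : W ∈ siegelH n := moeb_mem g₀ hZ
  have hmax : ∀ h : SpZ n, (imPart (moeb h W)).det ≤ 2 * (imPart W).det := fun h => by
    have := hle (h * g₀)
    rw [moeb_mul h g₀ hZ] at this
    linarith
  obtain ⟨B, -, hB⟩ := exists_conjTranspose_mul_self_of_posDef hWm.2
  set v : Fin n → EuclideanSpace ℝ (Fin n) := fun j => WithLp.toLp 2 (fun a => B a j) with hv
  have hgram : ∀ (U V : Matrix (Fin n) (Fin n) ℤ) (h : U * V = 1) (x : Fin n → ℝ),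
      ‖∑ i, x i • ∑ j, U i j • v j‖ ^ 2 = x ⬝ᵥ (imPart (moeb (levi U V h) W) *ᵥ x) := by
    intro U V h x
    have e : ∑ i, x i • ∑ j, U i j • v j =
        ∑ j, ((U.map (Int.cast : ℤ → ℝ))ᵀ *ᵥ x) j • v j := by
      simp only [Finset.smul_sum, mulVec, dotProduct, Finset.sum_smul, transpose_apply, map_apply,
        ← Int.cast_smul_eq_zsmul ℝ, smul_smul, mul_comm]
      exact Finset.sum_comm
    rw [e, hv, norm_sq_sum_smul_columns, ← hB, imPart_moeb_levi h W, ← mulVec_mulVec,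
      ← mulVec_mulVec, dotProduct_mulVec x, ← mulVec_transpose]
  obtain ⟨w, ⟨U, V, hUV, hw⟩, hwred⟩ := hred v (1 / 2) (by norm_num) (by
    -- A partial inversion at a diagonal entry of small modulus would increase the height.
    rintro w ⟨U, V, hUV, hw⟩ i
    set Z₁ := moeb (levi U V hUV) W with hZ₁
    have hZ₁m : Z₁ ∈ siegelH n := moeb_mem _ hWm
    have hnorm : ‖w i‖ ^ 2 = (Z₁ i i).im := by
      have := hgram U V hUV (Pi.single i 1)
      simpa [hw, Pi.single_apply, ite_smul, mulVec_single_one, imPart] using this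
    have hdet : (imPart Z₁).det = (imPart W).det := by
      have h1 := congrArg (fun A : Matrix (Fin n) (Fin n) ℤ => (A.det : ℝ)) hUV
      have h2 : (U.map (Int.cast : ℤ → ℝ)).det = (U.det : ℝ) :=
        ((Int.castRingHom ℝ).map_det U).symm
      have h3 : U.det * U.det = 1 := Int.isUnit_mul_self
        (IsUnit.of_mul_eq_one V.det (by rw [← det_mul, hUV, det_one]))
      rw [hZ₁, imPart_moeb_levi hUV W, det_mul, det_mul, det_transpose, h2, mul_right_comm]
      rw [show ((U.det : ℝ) * (U.det : ℝ)) = 1 by exact_mod_cast h3, one_mul]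
    set s : ℤ := -round (Z₁ i i).re with hs
    have h1 := det_imPart_moeb (partialInversion i s) hZ₁m
    have h2 := hmax (partialInversion i s * levi U V hUV)
    rw [moeb_mul _ _ hWm, ← hZ₁] at h2
    rw [autFactor_partialInversion, hdet] at h1
    have h3 : 1 / 2 ≤ ‖Z₁ i i + s‖ ^ 2 := by
      have h4 := hWm.2.det_pos
      by_contra! hlt
      nlinarith [sq_nonneg ‖Z₁ i i + (s : ℂ)‖]
    rw [Complex.sq_norm, Complex.normSq_apply] at h3
    have h5 : |(Z₁ i i + (s : ℂ)).re| ≤ 1 / 2 := by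
      have := abs_sub_round (Z₁ i i).re
      simpa [hs, sub_eq_add_neg] using this
    have h6 : (Z₁ i i + (s : ℂ)).im = (Z₁ i i).im := by simp
    rw [h6] at h3
    have h7 : (Z₁ i i + (s : ℂ)).re * (Z₁ i i + (s : ℂ)).re ≤ 1 / 4 := by
      rw [← abs_mul_abs_self]
      nlinarith [abs_nonneg (Z₁ i i + (s : ℂ)).re]
    rw [hnorm]
    have h8 : 0 ≤ (Z₁ i i).im := hnorm ▸ sq_nonneg _
    nlinarith)
  refine ⟨levi U V hUV * g₀, ?_⟩
  rw [moeb_mul _ _ hZ, ← hW]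
  refine .of_dotProduct_mulVec_nonneg ?_ fun x => ?_
  · exact (moeb_mem _ hWm).2.isHermitian.sub
      ((PosSemidef.one.smul (by positivity : (0 : ℝ) ≤ ε * (1 / 2))).isHermitian)
  · have h := hwred x
    rw [funext hw, hgram U V hUV x] at h
    simp only [star_trivial, sub_mulVec, dotProduct_sub, smul_mulVec, one_mulVec, dotProduct_smul,
      smul_eq_mul, sub_nonneg]
    simpa [dotProduct, pow_two] using h

/-! ### Cusp forms are bounded -/

theorem det_mul_det_le_exp_trace {ι : Type*} [Fintype ι] [DecidableEq ι] {T Y : Matrix ι ι ℝ}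
    (hT : T.PosSemidef) (hY : Y.PosDef) : T.det * Y.det ≤ Real.exp (T * Y).trace := by
  obtain ⟨B, -, rfl⟩ := exists_conjTranspose_mul_self_of_posDef hY
  have h := hT.mul_mul_conjTranspose_same B
  rw [conjTranspose_eq_transpose_of_trivial] at h
  have e1 : T.det * (Bᵀ * B).det = (B * T * Bᵀ).det := by
    simp only [det_mul, det_transpose]
    ring
  have e2 : (T * (Bᵀ * B)).trace = (B * T * Bᵀ).trace := by
    rw [← Matrix.mul_assoc, trace_mul_comm, Matrix.mul_assoc]
  rw [e1, e2, h.isHermitian.det_eq_prod_eigenvalues, h.isHermitian.trace_eq_sum_eigenvalues]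
  simp only [RCLike.ofReal_real_eq_id, id]
  rw [Real.exp_sum]
  refine Finset.prod_le_prod (fun i _ => h.eigenvalues_nonneg i) fun i _ => ?_
  linarith [Real.add_one_le_exp (h.isHermitian.eigenvalues i)]

theorem mul_trace_le_trace_mul {ι : Type*} [Fintype ι] [DecidableEq ι] {T Y : Matrix ι ι ℝ}
    (hT : T.PosDef) {ε : ℝ} (hY : (Y - ε • (1 : Matrix ι ι ℝ)).PosSemidef) :
    ε * T.trace ≤ (T * Y).trace := by
  obtain ⟨B, -, rfl⟩ := exists_conjTranspose_mul_self_of_posDef hT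
  have h := (hY.mul_mul_conjTranspose_same B).trace_nonneg
  rw [conjTranspose_eq_transpose_of_trivial, trace_mul_comm, ← Matrix.mul_assoc, Matrix.mul_sub,
    trace_sub, Matrix.mul_smul, trace_smul, Matrix.mul_one, smul_eq_mul] at h
  linarith

theorem norm_expTrace {n : ℕ} (T : Matrix (Fin n) (Fin n) ℝ) (Z : Matrix (Fin n) (Fin n) ℂ) :
    ‖expTrace T Z‖ = Real.exp (-(2 * Real.pi * (T * imPart Z).trace)) := by
  have e : (T.map Complex.ofReal * Z).trace.im = (T * imPart Z).trace := by
    simp [Matrix.trace, Matrix.mul_apply, Complex.im_sum, imPart]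
  rw [expTrace, Complex.norm_exp, ← e]
  congr 1
  simp [Complex.mul_re, Complex.mul_im]

/-- A positive definite `T` in the dual of a lattice containing `N` times all integral symmetric
matrices is `(2N)⁻¹` times an integral matrix. -/
theorem one_le_det_of_mem_posDual {n N : ℕ} (hN : 1 ≤ N) {Γ : Subgroup (SpZ n)}
    (hΓ : ∀ S : Matrix (Fin n) (Fin n) ℤ, Sᵀ = S → (N : ℤ) • S ∈ transLattice Γ)
    {T : Matrix (Fin n) (Fin n) ℝ} (hT : T ∈ posDual Γ) :
    1 ≤ ((2 * N : ℝ) • T).det := by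
  have hint : ∀ i j, ∃ q : ℤ, (2 * N : ℝ) * T i j = q := fun i j => by
    obtain ⟨q, hq⟩ := hT.2 _ (hΓ (single i j 1 + single j i 1) (by simp [add_comm]))
    refine ⟨q, hq ▸ ?_⟩
    have hs : T j i = T i j := by simpa using hT.1.isHermitian.apply i j
    have e : ((N : ℤ) • (single i j 1 + single j i 1 : Matrix (Fin n) (Fin n) ℤ)).map
        (Int.cast : ℤ → ℝ) = (N : ℝ) • (single i j 1 + single j i 1) := by
      ext a b
      simp [single_apply, apply_ite (Int.cast : ℤ → ℝ), mul_add]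
    rw [e, Matrix.mul_smul, trace_smul, Matrix.mul_add, trace_add, trace_mul_single,
      trace_mul_single]
    simp [hs]
    ring
  choose q hq using hint
  have e : (2 * N : ℝ) • T = (Int.castRingHom ℝ).mapMatrix (Matrix.of q) := by
    ext i j
    simp [hq]
  have hN' : (0 : ℝ) < 2 * N := by positivity
  have h := (hT.1.smul hN').det_pos
  rw [e, ← RingHom.map_det, eq_intCast] at h ⊢
  exact_mod_cast h

/-- A Fourier series supported on positive definite matrices with bounded denominators is bounded
by a multiple of `det(Y)^{-k/2}` on `Y ≥ ε`: half of the exponential decay absorbs the power of the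
determinant, the other half is dominated by the series at `i(ε/2)`. -/
theorem exists_height_le_of_hasSum {n N : ℕ} (hN : 1 ≤ N) {Γ : Subgroup (SpZ n)}
    (hΓ : ∀ S : Matrix (Fin n) (Fin n) ℤ, Sᵀ = S → (N : ℤ) • S ∈ transLattice Γ) (k : ℕ)
    {f : Matrix (Fin n) (Fin n) ℂ → ℂ} {a : posDual Γ → ℂ}
    (hf : ∀ Z ∈ siegelH n, HasSum (fun T => a T * expTrace T.1 Z) (f Z)) {ε : ℝ} (hε : 0 < ε) :
    ∃ M : ℝ, ∀ Z ∈ siegelH n, (imPart Z - ε • (1 : Matrix (Fin n) (Fin n) ℝ)).PosSemidef →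
      height k f Z ≤ M := by
  set Z₀ : Matrix (Fin n) (Fin n) ℂ := (Complex.I * (ε / 2 : ℝ)) • 1 with hZ₀
  have him : imPart Z₀ = (ε / 2) • (1 : Matrix (Fin n) (Fin n) ℝ) := by
    ext i j
    simp only [imPart, hZ₀, map_apply, Matrix.smul_apply, Matrix.one_apply]
    split_ifs <;> simp
  have hZ₀m : Z₀ ∈ siegelH n := ⟨by simp [hZ₀], him ▸ PosDef.one.smul (by positivity)⟩
  have hsum := (hf Z₀ hZ₀m).summable.norm
  have hterm : ∀ T : posDual Γ, ‖a T * expTrace T.1 Z₀‖ =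
      ‖a T‖ * Real.exp (-(Real.pi * (ε * T.1.trace))) := fun T => by
    rw [norm_mul, norm_expTrace, him, Matrix.mul_smul, Matrix.mul_one, trace_smul, smul_eq_mul]
    congr 3
    ring
  simp only [hterm] at hsum
  -- The inequality `det ≤ exp tr` for `s • TY` is raised to the power `k`; any `s > 0` with
  -- `k s ≤ 2π` would do, and this one also covers `k = 0`.
  set s : ℝ := (k + 1 : ℝ)⁻¹ with hs
  have hs0 : 0 < s := by positivity
  set c : ℝ := (((2 * N) / s) ^ n) ^ k with hc
  have hc0 : 0 ≤ c := by positivity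
  refine ⟨(√c * ∑' T : posDual Γ, ‖a T‖ * Real.exp (-(Real.pi * (ε * T.1.trace)))) ^ 2,
    fun Z hZ hY => ?_⟩
  have hdet0 : 0 < (imPart Z).det := hZ.2.det_pos
  have hmain : √((imPart Z).det ^ k) * ‖f Z‖ ≤
      √c * ∑' T : posDual Γ, ‖a T‖ * Real.exp (-(Real.pi * (ε * T.1.trace))) := by
    have hn : ‖(√((imPart Z).det ^ k) : ℂ) * f Z‖ = √((imPart Z).det ^ k) * ‖f Z‖ := by
      rw [norm_mul, Complex.norm_real, Real.norm_of_nonneg (Real.sqrt_nonneg _)]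
    rw [← hn]
    refine ((hf Z hZ).mul_left _).norm_le_of_bounded (hsum.hasSum.mul_left _) fun T => ?_
    set τ := (T.1 * imPart Z).trace with hτ
    have htr : ε * T.1.trace ≤ τ := mul_trace_le_trace_mul T.2.1 hY
    have htr0 : 0 ≤ τ := (mul_nonneg hε.le T.2.1.posSemidef.trace_nonneg).trans htr
    have hdet : (imPart Z).det ^ k ≤ c * Real.exp (2 * Real.pi * τ) := by
      have hN' : (0 : ℝ) < 2 * N := by positivity
      have h1 := det_mul_det_le_exp_trace (T.2.1.smul hN').posSemidef
        (hZ.2.smul (show 0 < s / (2 * N) by positivity))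
      rw [Matrix.mul_smul, Matrix.smul_mul, smul_smul, trace_smul, ← hτ,
        div_mul_cancel₀ _ hN'.ne', smul_eq_mul, det_smul (imPart Z), Fintype.card_fin] at h1
      have h2 : (s / (2 * N)) ^ n * (imPart Z).det ≤ Real.exp (s * τ) :=
        (le_mul_of_one_le_left (by positivity) (one_le_det_of_mem_posDual hN hΓ T.2)).trans h1
      have h3 : (imPart Z).det ≤ ((2 * N) / s) ^ n * Real.exp (s * τ) := by
        calc (imPart Z).det = ((2 * N) / s) ^ n * ((s / (2 * N)) ^ n * (imPart Z).det) := by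
              rw [← mul_assoc, ← mul_pow]
              field_simp
              simp
          _ ≤ _ := by gcongr
      calc (imPart Z).det ^ k ≤ (((2 * N) / s) ^ n * Real.exp (s * τ)) ^ k := by gcongr
        _ = c * Real.exp (k * (s * τ)) := by rw [mul_pow, Real.exp_nat_mul]
        _ ≤ c * Real.exp (2 * Real.pi * τ) := by
          refine mul_le_mul_of_nonneg_left (Real.exp_le_exp.2 ?_) hc0
          rw [← mul_assoc]
          refine mul_le_mul_of_nonneg_right ?_ htr0
          have h4 : k * s ≤ 1 := by
            rw [hs, ← div_eq_mul_inv, div_le_one (by positivity)]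
            linarith
          linarith [Real.pi_gt_three]
    have hsq : √((imPart Z).det ^ k) ≤ √c * Real.exp (Real.pi * τ) := by
      refine (Real.sqrt_le_sqrt hdet).trans (le_of_eq ?_)
      rw [Real.sqrt_mul hc0, mul_assoc, two_mul, Real.exp_add,
        Real.sqrt_mul_self (Real.exp_pos _).le]
    rw [norm_mul, Complex.norm_real, Real.norm_of_nonneg (Real.sqrt_nonneg _), norm_mul,
      norm_expTrace, ← hτ]
    calc √((imPart Z).det ^ k) * (‖a T‖ * Real.exp (-(2 * Real.pi * τ)))
        ≤ √c * Real.exp (Real.pi * τ) * (‖a T‖ * Real.exp (-(2 * Real.pi * τ))) := by gcongr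
      _ = √c * (‖a T‖ * Real.exp (-(Real.pi * τ))) := by
        have : Real.exp (-(Real.pi * τ)) =
            Real.exp (Real.pi * τ) * Real.exp (-(2 * Real.pi * τ)) := by
          rw [← Real.exp_add]
          ring_nf
        rw [this]
        ring
      _ ≤ √c * (‖a T‖ * Real.exp (-(Real.pi * (ε * T.1.trace)))) := by gcongr
  have h := pow_le_pow_left₀ (by positivity) hmain 2
  rwa [mul_pow, Real.sq_sqrt (by positivity)] at h

theorem dvd_mul_apply {ι : Type*} [Fintype ι] {N : ℤ} {A : Matrix ι ι ℤ}
    (hA : ∀ i j, N ∣ A i j) (B : Matrix ι ι ℤ) : ∀ i j, N ∣ (A * B) i j := fun i j => by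
  rw [Matrix.mul_apply]
  exact Finset.dvd_sum fun k _ => (hA i k).mul_right _

theorem dvd_mul_apply' {ι : Type*} [Fintype ι] {N : ℤ} {A : Matrix ι ι ℤ}
    (hA : ∀ i j, N ∣ A i j) (B : Matrix ι ι ℤ) : ∀ i j, N ∣ (B * A) i j := fun i j => by
  rw [Matrix.mul_apply]
  exact Finset.dvd_sum fun k _ => (hA k j).mul_left _

/-- Two modular matrices congruent modulo `N` differ by an element of `Γ(N)`. -/
theorem mul_inv_mem_principalCongruence {n N : ℕ} {g h : SpZ n}
    (hgh : ∀ i j, (N : ℤ) ∣ (g.1 - h.1) i j) : g * h⁻¹ ∈ principalCongruence n N := by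
  intro i j
  have h1 : h.1 * (h⁻¹).1 = 1 := congrArg Subtype.val (mul_inv_cancel h)
  have h2 : (g * h⁻¹).1 - 1 = (g.1 - h.1) * (h⁻¹).1 := by
    rw [Matrix.sub_mul, h1]
    rfl
  have := dvd_mul_apply hgh (h⁻¹).1 i j
  rwa [← h2] at this

/-- As `Γ(N)` is normal, the translation lattices of all conjugates of a group containing `Γ(N)`
contain `N` times the integral symmetric matrices. -/
theorem smul_mem_transLattice_conjSubgroup {n N : ℕ} {Γ : Subgroup (SpZ n)}
    (hΓ : principalCongruence n N ⊆ (Γ : Set (SpZ n))) (g : SpZ n)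
    {S : Matrix (Fin n) (Fin n) ℤ} (hS : Sᵀ = S) :
    (N : ℤ) • S ∈ transLattice (conjSubgroup Γ g) := by
  have hNS : ((N : ℤ) • S)ᵀ = (N : ℤ) • S := by rw [transpose_smul, hS]
  have hdvd : ∀ i j, (N : ℤ) ∣ ((N : ℤ) • S) i j := fun i j => ⟨S i j, rfl⟩
  generalize (N : ℤ) • S = R at hNS hdvd
  have hmem : fromBlocks 1 R 0 1 ∈ symplecticGroup (Fin n) ℤ :=
    SymplecticGroup.fromBlocks_mem_iff.2 (by simp [hNS])
  set τ : SpZ n := ⟨_, hmem⟩ with hτ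
  refine ⟨hNS, τ, ⟨g * τ * g⁻¹, hΓ ?_, ?_⟩, rfl⟩
  · intro i j
    have h1 : g.1 * (g⁻¹).1 = 1 := congrArg Subtype.val (mul_inv_cancel g)
    have h2 : (g * τ * g⁻¹).1 - 1 = g.1 * (τ.1 - 1) * (g⁻¹).1 := by
      rw [Matrix.mul_sub, Matrix.sub_mul, Matrix.mul_one, h1]
      rfl
    have h3 : ∀ i j, (N : ℤ) ∣ (τ.1 - 1) i j := by
      rintro (i | i) (j | j) <;> simp [hτ, Matrix.one_apply, hdvd]
    have := dvd_mul_apply (dvd_mul_apply' h3 g.1) (g⁻¹).1 i j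
    rwa [← h2] at this
  · simp [mul_assoc]

theorem height_moeb_of_mem {n k : ℕ} {Γ : Subgroup (SpZ n)} {F : Matrix (Fin n) (Fin n) ℂ → ℂ}
    (hF : F ∈ cuspForms k Γ) {γ : SpZ n} (hγ : γ ∈ Γ) {Z : Matrix (Fin n) (Fin n) ℂ}
    (hZ : Z ∈ siegelH n) : height k F (moeb γ Z) = height k F Z := by
  rw [height_moeb k F γ hZ, height, hF.2.2.1 γ hγ Z hZ, height]

/-- Cusp forms for congruence subgroups are bounded: every point is equivalent to one with
`Y ≥ ε`, on which the Fourier expansions for the finitely many cosets of `Γ` give a bound. -/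
theorem exists_height_le {n k : ℕ} {Γ : Subgroup (SpZ n)} (hΓ : IsCongruence Γ)
    {F : Matrix (Fin n) (Fin n) ℂ → ℂ} (hF : F ∈ cuspForms k Γ) :
    ∃ M : ℝ, ∀ Z ∈ siegelH n, height k F Z ≤ M := by
  obtain ⟨N, hN, hNΓ⟩ := hΓ
  obtain ⟨ε, hε, hred⟩ := exists_moeb_imPart_ge n
  have hbound : ∀ g : SpZ n, ∃ M : ℝ, ∀ Z ∈ siegelH n,
      (imPart Z - ε • (1 : Matrix (Fin n) (Fin n) ℝ)).PosSemidef →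
        height k F (moeb g Z) ≤ M := fun g => by
    obtain ⟨a, ha⟩ := hF.2.2.2 g
    obtain ⟨M, hM⟩ := exists_height_le_of_hasSum hN
      (fun S hS => smul_mem_transLattice_conjSubgroup hNΓ g hS) k ha hε
    exact ⟨M, fun Z hZ hY => (height_moeb k F g hZ).trans_le (hM Z hZ hY)⟩
  choose M hM using hbound
  -- The reduction modulo `N` takes finitely many values; fix a representative of each.
  have : NeZero N := ⟨by omega⟩
  set r : SpZ n → Matrix (Fin n ⊕ Fin n) (Fin n ⊕ Fin n) (ZMod N) :=
    fun g => g.1.map (Int.cast : ℤ → ZMod N) with hr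
  obtain ⟨K, hK⟩ := (Set.finite_range fun x : Set.range r => M x.2.choose).bddAbove
  refine ⟨K, fun Z hZ => ?_⟩
  obtain ⟨g, hg⟩ := hred Z hZ
  set x : Set.range r := ⟨r g⁻¹, g⁻¹, rfl⟩ with hx
  have hxr : r x.2.choose = r g⁻¹ := x.2.choose_spec
  set h := x.2.choose with hh
  have hcong : ∀ i j, (N : ℤ) ∣ ((g⁻¹).1 - h.1) i j := fun i j => by
    have := congrFun (congrFun hxr i) j
    simp only [hr, map_apply] at this
    rw [Matrix.sub_apply, ← ZMod.intCast_zmod_eq_zero_iff_dvd]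
    simp [this]
  have hmem : g⁻¹ * h⁻¹ ∈ Γ := hNΓ (mul_inv_mem_principalCongruence hcong)
  have hgZ := moeb_mem g hZ
  have e : moeb (g⁻¹ * h⁻¹) (moeb h (moeb g Z)) = Z := by
    rw [← moeb_mul _ _ hgZ, inv_mul_cancel_right, ← moeb_mul _ _ hZ, inv_mul_cancel, moeb_one]
  calc height k F Z = height k F (moeb h (moeb g Z)) := by
        rw [← height_moeb_of_mem hF hmem (moeb_mem h hgZ), e]
    _ ≤ M h := hM h _ hgZ hg
    _ ≤ K := hK ⟨x, rfl⟩

/-! ### Products and powers of cusp forms -/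

theorem expTrace_add {n : ℕ} (S T : Matrix (Fin n) (Fin n) ℝ) (Z : Matrix (Fin n) (Fin n) ℂ) :
    expTrace (S + T) Z = expTrace S Z * expTrace T Z := by
  have e : (S + T).map Complex.ofReal = S.map Complex.ofReal + T.map Complex.ofReal := by
    ext i j
    simp
  rw [expTrace, expTrace, expTrace, ← Complex.exp_add, e, Matrix.add_mul, trace_add, mul_add]

theorem add_mem_posDual {n : ℕ} {Γ : Subgroup (SpZ n)} {S T : Matrix (Fin n) (Fin n) ℝ}
    (hS : S ∈ posDual Γ) (hT : T ∈ posDual Γ) : S + T ∈ posDual Γ := by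
  refine ⟨hS.1.add hT.1, fun R hR => ?_⟩
  obtain ⟨p, hp⟩ := hS.2 R hR
  obtain ⟨q, hq⟩ := hT.2 R hR
  exact ⟨p + q, by rw [Matrix.add_mul, trace_add, hp, hq, Int.cast_add]⟩

/-- The Cauchy product of two absolutely convergent Fourier series over `Λ_Γ`; a coefficient of
the product is itself an infinite series. -/
theorem exists_hasSum_mul {n : ℕ} {Γ : Subgroup (SpZ n)} {a b : posDual Γ → ℂ}
    {f g : Matrix (Fin n) (Fin n) ℂ → ℂ}
    (hf : ∀ Z ∈ siegelH n, HasSum (fun T => a T * expTrace T.1 Z) (f Z))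
    (hg : ∀ Z ∈ siegelH n, HasSum (fun T => b T * expTrace T.1 Z) (g Z)) :
    ∃ c : posDual Γ → ℂ, ∀ Z ∈ siegelH n,
      HasSum (fun T => c T * expTrace T.1 Z) (f Z * g Z) := by
  let s : posDual Γ × posDual Γ → posDual Γ := fun p => ⟨p.1.1 + p.2.1, add_mem_posDual p.1.2 p.2.2⟩
  refine ⟨fun T => ∑' p : {p // s p = T}, a p.1.1 * b p.1.2, fun Z hZ => ?_⟩
  have hs := summable_mul_of_summable_norm (hf Z hZ).summable.norm (hg Z hZ).summable.norm
  have h := (Equiv.sigmaFiberEquiv s).hasSum_iff.2 ((hf Z hZ).mul (hg Z hZ) hs)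
  have hfib : ∀ (T : posDual Γ) (p : {p // s p = T}),
      a p.1.1 * expTrace p.1.1.1 Z * (b p.1.2 * expTrace p.1.2.1 Z) =
        a p.1.1 * b p.1.2 * expTrace T.1 Z := by
    rintro T ⟨p, rfl⟩
    rw [show (s p).1 = p.1.1 + p.2.1 from rfl, expTrace_add]
    ring
  refine h.sigma fun T => ?_
  have hT := h.summable.sigma_factor T
  have e : (fun p : {p // s p = T} => (((fun x : posDual Γ × posDual Γ =>
      a x.1 * expTrace x.1.1 Z * (b x.2 * expTrace x.2.1 Z)) ∘ Equiv.sigmaFiberEquiv s) ⟨T, p⟩)) =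
      fun p => a p.1.1 * b p.1.2 * expTrace T.1 Z := funext fun p => hfib T p
  rw [e] at hT ⊢
  rw [← tsum_mul_right]
  exact hT.hasSum

theorem slash_mul {n : ℕ} (k l : ℕ) (F G : Matrix (Fin n) (Fin n) ℂ → ℂ) (g : SpZ n)
    (Z : Matrix (Fin n) (Fin n) ℂ) :
    slash (k + l) (F * G) g Z = slash k F g Z * slash l G g Z := by
  simp only [slash, Pi.mul_apply, pow_add, mul_inv]
  ring

theorem mul_mem_cuspForms {n k l : ℕ} {Γ : Subgroup (SpZ n)}
    {F G : Matrix (Fin n) (Fin n) ℂ → ℂ} (hF : F ∈ cuspForms k Γ) (hG : G ∈ cuspForms l Γ) :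
    F * G ∈ cuspForms (k + l) Γ := by
  obtain ⟨hF0, hF1, hF2, hF3⟩ := hF
  obtain ⟨hG0, hG1, hG2, hG3⟩ := hG
  refine ⟨fun Z hZ => by simp [hF0 Z hZ], hF1.mul hG1, fun γ hγ Z hZ => ?_, fun g => ?_⟩
  · rw [slash_mul, hF2 γ hγ Z hZ, hG2 γ hγ Z hZ, Pi.mul_apply]
  · obtain ⟨a, ha⟩ := hF3 g
    obtain ⟨b, hb⟩ := hG3 g
    simp only [slash_mul]
    exact exists_hasSum_mul ha hb

/-- The exponent has to be positive because forms are extended by zero, whereas `F ^ 0 = 1`. -/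
theorem pow_mem_cuspForms {n k : ℕ} {Γ : Subgroup (SpZ n)} {F : Matrix (Fin n) (Fin n) ℂ → ℂ}
    (hF : F ∈ cuspForms k Γ) {m : ℕ} (hm : 1 ≤ m) : F ^ m ∈ cuspForms (k * m) Γ := by
  induction m, hm using Nat.le_induction with
  | base => simpa using hF
  | succ m _ ih =>
    rw [pow_succ, Nat.mul_succ]
    exact mul_mem_cuspForms ih hF

theorem height_pow {n : ℕ} (k m : ℕ) (F : Matrix (Fin n) (Fin n) ℂ → ℂ)
    (Z : Matrix (Fin n) (Fin n) ℂ) : height (k * m) (F ^ m) Z = height k F Z ^ m := by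
  simp only [height, Pi.pow_apply, norm_pow, mul_pow, pow_mul]
  rw [← pow_mul, ← pow_mul, ← pow_mul, mul_comm 2 m]

/-! ### The size bounds every normalised form -/

theorem petersson_self {n : ℕ} (k : ℕ) (𝓕 : Set (Matrix (Fin n) (Fin n) ℂ))
    (F : Matrix (Fin n) (Fin n) ℂ → ℂ) : petersson k 𝓕 F F =
      ((∫ z in {z | symMat z ∈ 𝓕}, height k F (symMat z) ∂(siegelMeasure n) : ℝ) : ℂ) := by
  rw [petersson, ← integral_complex_ofReal]
  congr 1
  ext z
  rw [Complex.mul_conj', height]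
  push_cast
  ring

/-- By Zorn's lemma, every normalised form belongs to an orthonormal basis. -/
theorem exists_isOrthonormalBasis_mem {n k : ℕ} {Γ : Subgroup (SpZ n)}
    {𝓕 : Set (Matrix (Fin n) (Fin n) ℂ)} {H : Matrix (Fin n) (Fin n) ℂ → ℂ}
    (hH : H ∈ cuspForms k Γ) (h1 : petersson k 𝓕 H H = 1) :
    ∃ B, IsOrthonormalBasis k Γ 𝓕 B ∧ H ∈ B := by
  have h0 : IsOrthonormalSet k Γ 𝓕 {H} :=
    ⟨by simpa using hH, by simpa using h1, by
      rintro F rfl G rfl hne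
      exact (hne rfl).elim⟩
  obtain ⟨B, hHB, hB⟩ := zorn_subset_nonempty {B | IsOrthonormalSet k Γ 𝓕 B} (by
    intro c hc hchain _
    refine ⟨⋃₀ c, ⟨Set.sUnion_subset fun B hB => (hc hB).1, ?_, ?_⟩,
      fun s hs => Set.subset_sUnion_of_mem hs⟩
    · rintro F ⟨B, hB, hF⟩
      exact (hc hB).2.1 F hF
    · rintro F ⟨B, hB, hF⟩ G ⟨B', hB', hG⟩ hne
      rcases hchain.total hB hB' with h | h
      · exact (hc hB').2.2 F (h hF) G hG hne
      · exact (hc hB).2.2 F hF G (h hG) hne) {H} h0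
  exact ⟨B, ⟨hB.prop, fun B' hB' hle => (hB.eq_of_subset hB' hle).symm⟩, hHB rfl⟩

theorem height_le_size {n k : ℕ} {Γ : Subgroup (SpZ n)}
    {𝓕 : Set (Matrix (Fin n) (Fin n) ℂ)} {H : Matrix (Fin n) (Fin n) ℂ → ℂ}
    (hH : H ∈ cuspForms k Γ) (h1 : petersson k 𝓕 H H = 1) {Z : Matrix (Fin n) (Fin n) ℂ}
    (hZ : Z ∈ siegelH n) : ENNReal.ofReal (height k H Z) ≤ size k Γ 𝓕 := by
  obtain ⟨B, hB, hHB⟩ := exists_isOrthonormalBasis_mem hH h1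
  calc ENNReal.ofReal (height k H Z) ≤ bergman k B Z :=
        ENNReal.le_tsum (f := fun F : B => ENNReal.ofReal ((imPart Z).det ^ k * ‖F.1 Z‖ ^ 2))
          ⟨H, hHB⟩
    _ ≤ size k Γ 𝓕 :=
        (le_iSup₂_of_le Z hZ le_rfl).trans (le_iSup₂_of_le
          (f := fun B (_ : IsOrthonormalBasis k Γ 𝓕 B) => ⨆ Z ∈ siegelH n, bergman k B Z)
          B hB le_rfl)

/-- The sup-norm of a normalised form `G` is controlled by the size in the weight of its power
`G ^ m`: with `s = sup_Z det(Y)^k |G|²` one has `⟨G^m, G^m⟩ ≤ s^(m-1)`, while `s^m` is at most the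
size times `⟨G^m, G^m⟩`. -/
theorem height_le_of_size_le {n k : ℕ} {Γ : Subgroup (SpZ n)} (hΓ : IsCongruence Γ)
    {𝓕 : Set (Matrix (Fin n) (Fin n) ℂ)} (h𝓕 : IsFundDomain Γ 𝓕)
    {G : Matrix (Fin n) (Fin n) ℂ → ℂ} (hG : G ∈ cuspForms k Γ) (h1 : petersson k 𝓕 G G = 1)
    {m : ℕ} (hm : 1 ≤ m) {K : ℝ} (hK : 0 ≤ K) (hsize : size (k * m) Γ 𝓕 ≤ ENNReal.ofReal K)
    {Z : Matrix (Fin n) (Fin n) ℂ} (hZ : Z ∈ siegelH n) : height k G Z ≤ K := by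
  set μ := (siegelMeasure n).restrict {z | symMat z ∈ 𝓕} with hμ
  set f : (Sym2 (Fin n) → ℂ) → ℝ := fun z => height k G (symMat z) with hf
  have hmem : ∀ᵐ z ∂μ, symMat z ∈ siegelH n :=
    (ae_restrict_mem h𝓕.1).mono fun z hz => h𝓕.2.1 hz
  have hf0 : 0 ≤ᵐ[μ] f := hmem.mono fun z hz => height_nonneg k G hz
  have hint1 : ∫ z, f z ∂μ = 1 := by
    rw [petersson_self] at h1
    exact_mod_cast h1
  -- Otherwise the integral would have the default value `0`.
  have hfi : Integrable f μ := by
    by_contra hni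
    rw [integral_undef hni] at hint1
    exact zero_ne_one hint1
  obtain ⟨M, hM⟩ := exists_height_le hΓ hG
  have hbdd : BddAbove (height k G '' siegelH n) := by
    refine ⟨M, ?_⟩
    rintro _ ⟨W, hW, rfl⟩
    exact hM W hW
  set s := sSup (height k G '' siegelH n) with hs
  have hle : ∀ W ∈ siegelH n, height k G W ≤ s := fun W hW => le_csSup hbdd ⟨W, hW, rfl⟩
  have hs0 : 0 ≤ s := (height_nonneg k G hZ).trans (hle Z hZ)
  obtain ⟨m, rfl⟩ : ∃ j, m = j + 1 := ⟨m - 1, by omega⟩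
  have hdom : ∀ᵐ z ∂μ, f z ^ (m + 1) ≤ s ^ m * f z := hmem.mono fun z hz => by
    have h0 := height_nonneg k G hz
    rw [pow_succ]
    exact mul_le_mul_of_nonneg_right (pow_le_pow_left₀ h0 (hle _ hz) m) h0
  have hfmi : Integrable (fun z => f z ^ (m + 1)) μ := by
    refine (hfi.const_mul (s ^ m)).mono' (hfi.aestronglyMeasurable.pow _) ?_
    filter_upwards [hdom, hf0] with z hz hz0
    rwa [Real.norm_of_nonneg (pow_nonneg hz0 _)]
  set I := ∫ z, f z ^ (m + 1) ∂μ with hI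
  have hIs : I ≤ s ^ m := by
    have := integral_mono_ae hfmi (hfi.const_mul (s ^ m)) hdom
    rwa [integral_const_mul, hint1, mul_one] at this
  have hfm0 : 0 ≤ᵐ[μ] fun z => f z ^ (m + 1) := hf0.mono fun z hz => pow_nonneg hz _
  have hI0 : 0 < I := by
    refine lt_of_le_of_ne (integral_nonneg_of_ae hfm0) fun h0 => ?_
    have h2 : f =ᵐ[μ] 0 := ((integral_eq_zero_iff_of_nonneg_ae hfm0 hfmi).1 h0.symm).mono
      fun z hz => eq_zero_of_pow_eq_zero hz
    rw [integral_congr_ae h2] at hint1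
    simp at hint1
  have hpet : petersson (k * (m + 1)) 𝓕 (G ^ (m + 1)) (G ^ (m + 1)) = I := by
    rw [petersson_self]
    simp only [height_pow]
    rfl
  -- The normalisation of `G ^ (m + 1)`.
  set c : ℂ := (((√I)⁻¹ : ℝ) : ℂ) with hc
  have hcn : ‖c‖ ^ 2 = I⁻¹ := by
    rw [hc, Complex.norm_real, Real.norm_of_nonneg (by positivity), inv_pow, Real.sq_sqrt hI0.le]
  have hheight : ∀ W, height (k * (m + 1)) (c • G ^ (m + 1)) W =
      I⁻¹ * height k G W ^ (m + 1) := fun W => by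
    rw [← height_pow, height, height, Pi.smul_apply, norm_smul, mul_pow, hcn]
    ring
  have hH1 : petersson (k * (m + 1)) 𝓕 (c • G ^ (m + 1)) (c • G ^ (m + 1)) = 1 := by
    rw [petersson_self]
    simp only [hheight]
    rw [integral_const_mul]
    change ((I⁻¹ * I : ℝ) : ℂ) = 1
    rw [inv_mul_cancel₀ hI0.ne', Complex.ofReal_one]
  have hpow : ∀ W ∈ siegelH n, height k G W ^ (m + 1) ≤ K * s ^ m := fun W hW => by
    have h2 := (height_le_size ((cuspForms _ Γ).smul_mem c (pow_mem_cuspForms hG hm)) hH1 hW).trans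
      hsize
    rw [ENNReal.ofReal_le_ofReal_iff hK, hheight, inv_mul_le_iff₀ hI0, mul_comm] at h2
    exact h2.trans (mul_le_mul_of_nonneg_left hIs hK)
  rcases hs0.eq_or_lt with hs0 | hs0
  · exact (hle Z hZ).trans (hs0 ▸ hK)
  refine (hle Z hZ).trans (le_of_mul_le_mul_right ?_ (pow_pos hs0 m))
  rw [← pow_succ']
  -- The bound for the `(m + 1)`-th powers passes to the supremum by taking roots.
  have h3 : s ≤ (K * s ^ m) ^ ((m + 1 : ℕ) : ℝ)⁻¹ := by
    refine csSup_le ⟨_, Z, hZ, rfl⟩ ?_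
    rintro _ ⟨W, hW, rfl⟩
    rw [← Real.pow_rpow_inv_natCast (height_nonneg k G hW) (Nat.succ_ne_zero m)]
    exact Real.rpow_le_rpow (pow_nonneg (height_nonneg k G hW) _) (hpow W hW) (by positivity)
  calc s ^ (m + 1) ≤ ((K * s ^ m) ^ ((m + 1 : ℕ) : ℝ)⁻¹) ^ (m + 1) :=
        pow_le_pow_left₀ hs0.le h3 _
    _ = K * s ^ m := Real.rpow_inv_natCast_pow (by positivity) (Nat.succ_ne_zero m)

theorem supNorm_le_of_height_le {n k : ℕ} {G : Matrix (Fin n) (Fin n) ℂ → ℂ} {K : ℝ}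
    (h : ∀ Z ∈ siegelH n, height k G Z ≤ K) : supNorm k G ≤ ENNReal.ofReal (√K) := by
  refine iSup₂_le fun Z hZ => ENNReal.ofReal_le_ofReal (Real.le_sqrt_of_sq_le ?_)
  have e : ((imPart Z).det ^ ((k : ℝ) / 2)) ^ 2 = (imPart Z).det ^ k := by
    rw [← Real.rpow_natCast, ← Real.rpow_mul hZ.2.det_pos.le, ← Real.rpow_natCast]
    norm_num
  rw [mul_pow, e]
  exact h Z hZ

/-- The bound for the sup-norm in terms of the size in weight `k * m`. -/
theorem supNorm_le_of_size_le {n k : ℕ} {Γ : Subgroup (SpZ n)} (hΓ : IsCongruence Γ)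
    {𝓕 : Set (Matrix (Fin n) (Fin n) ℂ)} (h𝓕 : IsFundDomain Γ 𝓕)
    {G : Matrix (Fin n) (Fin n) ℂ → ℂ} (hG : G ∈ cuspForms k Γ) (h1 : petersson k 𝓕 G G = 1)
    {m : ℕ} (hm : 1 ≤ m) {C α : ℝ}
    (hsize : size (k * m) Γ 𝓕 ≤ ENNReal.ofReal (C * ((k * m : ℕ) : ℝ) ^ (2 * α))) :
    supNorm k G ≤ ENNReal.ofReal (√(max C 0) * (m : ℝ) ^ α * (k : ℝ) ^ α) := by
  have hx : (0 : ℝ) ≤ ((k * m : ℕ) : ℝ) := Nat.cast_nonneg _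
  have hK : 0 ≤ max C 0 * ((k * m : ℕ) : ℝ) ^ (2 * α) := by positivity
  have hsize' := hsize.trans (ENNReal.ofReal_le_ofReal (mul_le_mul_of_nonneg_right
    (le_max_left C 0) (by positivity : 0 ≤ ((k * m : ℕ) : ℝ) ^ (2 * α))))
  refine (supNorm_le_of_height_le fun Z hZ =>
    height_le_of_size_le hΓ h𝓕 hG h1 hm hK hsize' hZ).trans (le_of_eq ?_)
  rw [Real.sqrt_mul (le_max_right C 0), mul_comm 2 α, Real.rpow_mul hx, Real.rpow_ofNat,
    Real.sqrt_sq (by positivity), Nat.cast_mul, Real.mul_rpow (by positivity) (by positivity),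
    mul_assoc, mul_comm ((m : ℝ) ^ α)]

end SiegelSize

end

theorem mainTheorem9 (n : ℕ) (hn : 1 ≤ n) (α : ℝ) (hα : 0 ≤ α) (κ₀ : ℕ) :
    -- weight and hybrid aspects: the constants do not depend on the weight
    (∀ C : ℝ, ∃ C' : ℝ, ∀ (Γ : Subgroup (SiegelSize.SpZ n)) (𝓕 : Set (Matrix (Fin n) (Fin n) ℂ)),
      SiegelSize.IsCongruence Γ → SiegelSize.IsFundDomain Γ 𝓕 →
      (∀ κ : ℕ, κ₀ ≤ κ →
        SiegelSize.size κ Γ 𝓕 ≤ ENNReal.ofReal (C * (κ : ℝ) ^ (2 * α))) →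
      ∀ k : ℕ, (n : ℝ) / 2 ≤ k → ∀ G ∈ SiegelSize.cuspForms k Γ,
        SiegelSize.petersson k 𝓕 G G = 1 →
        SiegelSize.supNorm k G ≤ ENNReal.ofReal (C' * (k : ℝ) ^ α)) ∧
    -- level aspect: the constants may depend on the weight, but not on the group
    (∀ C : ℕ → ℝ, ∀ k : ℕ, (n : ℝ) / 2 ≤ k → ∃ C' : ℝ,
      ∀ (Γ : Subgroup (SiegelSize.SpZ n)) (𝓕 : Set (Matrix (Fin n) (Fin n) ℂ)),
      SiegelSize.IsCongruence Γ → SiegelSize.IsFundDomain Γ 𝓕 →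
      (∀ κ : ℕ, κ₀ ≤ κ →
        SiegelSize.size κ Γ 𝓕 ≤ ENNReal.ofReal (C κ * (κ : ℝ) ^ (2 * α))) →
      ∀ G ∈ SiegelSize.cuspForms k Γ,
        SiegelSize.petersson k 𝓕 G G = 1 →
        SiegelSize.supNorm k G ≤ ENNReal.ofReal (C' * (k : ℝ) ^ α)) := by
  have hm : 1 ≤ max κ₀ 1 := le_max_right _ _
  have hκ : ∀ k : ℕ, (n : ℝ) / 2 ≤ k → κ₀ ≤ k * max κ₀ 1 := fun k hk => by
    have hk1 : 1 ≤ k := by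
      have : (1 : ℝ) ≤ n := by exact_mod_cast hn
      have : (0 : ℝ) < k := by linarith
      exact_mod_cast this
    exact (le_max_left κ₀ 1).trans (Nat.le_mul_of_pos_left _ hk1)
  refine ⟨fun C => ⟨√(max C 0) * ((max κ₀ 1 : ℕ) : ℝ) ^ α,
      fun Γ 𝓕 hΓ h𝓕 hsize k hk G hG h1 => ?_⟩,
    fun C k hk => ⟨√(max (C (k * max κ₀ 1)) 0) * ((max κ₀ 1 : ℕ) : ℝ) ^ α,
      fun Γ 𝓕 hΓ h𝓕 hsize G hG h1 => ?_⟩⟩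
  · exact SiegelSize.supNorm_le_of_size_le hΓ h𝓕 hG h1 hm (hsize _ (hκ k hk))
  · exact SiegelSize.supNorm_le_of_size_le hΓ h𝓕 hG h1 hm (hsize _ (hκ k hk))
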